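/- Consider a continuous time random walk with finitely many internal states, grouped into $j$ blocks; block $i$ has $n_i\ge 1$ states $(i,r)$, $1\le r\le n_i$. The internal states form a Markov chain with transition matrix $M={\rm diag}(M_1,\dots,M_j)$, where each $M_i$ is an irreducible row-stochastic $n_i\times n_i$ matrix, and with initial distribution $\lambda=(\lambda_{i,r})$. In state $(i,r)$ the particle first waits a positive random time whose law has Laplace transform $\phi_{i,r}(s)$ with $1-\phi_{i,r}(s)\sim B_{i,r}s^{\alpha_{i,r}}$ as $s\to0^+$, where $0<\alpha_{i,r}<1$ and $B_{i,r}>0$, and then makes a Gaussian jump with mean $0$ and variance $2\sigma^2$, $\sigma>0$ (characteristic function $e^{-\sigma^2k^2}=1-\sigma^2k^2+o(k^2)$); given the states, all waiting times and jumps are independent. Let $X(t)$ be the position at time $t$, with $X(0^-)=0$, let $g(k,s)=\int_0^\infty e^{-st}\,\mathbb E[e^{ikX(t)}]\,dt$ be the Fourier-Laplace transform of its law, and let $\langle x^2(t)\rangle=\mathbb E[X(t)^2]$. Let $C=\{i:\lambda_{i,r}\ne0\text{ for some }r\}$ be the set of blocks charged by the initial distribution. Then $M$ has an equilibrium distribution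 (a probability vector $\varepsilon=(\varepsilon_{i,r})$ with $\varepsilon M=\varepsilon$) that vanishes identically on no block. Let $\varepsilon$ be any equilibrium distribution of $M$ that vanishes identically on no block of $C$, and write $\bar\lambda_i=\sum_r\lambda_{i,r}$, $\bar\varepsilon_i=\sum_r\varepsilon_{i,r}$ and $\psi_i(s)=\sum_r B_{i,r}s^{\alpha_{i,r}}\varepsilon_{i,r}$. Then 1. as $(k,s)\to(0,0^+)$, $$g(k,s)\sim\sum_{i\in C}\frac1s\,\frac{\psi_i(s)\,\bar\lambda_i}{\psi_i(s)+\sigma^2k^2\,\bar\varepsilon_i};$$ 2. as $s\to0^+$, $$\int_0^\infty e^{-st}\langle x^2(t)\rangle\,dt\sim\sum_{i\in C}\frac{2\sigma^2\,\bar\lambda_i\,\bar\varepsilon_i}{s\,\psi_i(s)};$$ 3. as $t\to\infty$, $\langle x^2(t)\rangle\sim c\,t^{\alpha^*}$, where $\alpha^*=\max_{i\in C}\min_{1\le r\le n_i}\alpha_{i,r}$ and $$c=\frac1{\Gamma(1+\alpha^*)}\sum_{i\in C,\ \min_r\alpha_{i,r}=\alpha^*}\frac{2\sigma^2\,\bar\lambda_i\,\bar\varepsilon_i}{\sum_{r:\,\alpha_{i,r}=\alpha^*}B_{i,r}\,\varepsilon_{i,r}}>0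 .$$ -/

import Mathlib

open Filter Topology MeasureTheory ProbabilityTheory
open scoped Asymptotics

noncomputable section

namespace FCP

/-- The law of a continuous time random walk with internal states in the finite type `S`.
`Z m`, `τ m`, `ξ m` are the internal state, the waiting time and the jump of the `m`-th step.
The states form a Markov chain with initial distribution `init` and transition matrix `M`
(`M a b` is the probability to go from `a` to `b`), and given the states, all the waiting times and
jumps are independent, with law `wait a`, respectively `jump a`, in state `a`. -/
structure IsInternalStateWalk {Ω S : Type*} [MeasurableSpace Ω] (P : Measure Ω)
    (init : S → ℝ) (M : Matrix S S ℝ) (wait jump : S → Measure ℝ)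
    (Z : ℕ → Ω → S) (τ ξ : ℕ → Ω → ℝ) : Prop where
  measurableSet_state : ∀ (m : ℕ) (a : S), MeasurableSet {ω | Z m ω = a}
  measurable_wait : ∀ m, Measurable (τ m)
  measurable_jump : ∀ m, Measurable (ξ m)
  law : ∀ (m : ℕ) (a : ℕ → S) (A C : ℕ → Set ℝ),
    (∀ l, MeasurableSet (A l)) → (∀ l, MeasurableSet (C l)) →
    P {ω | ∀ l ≤ m, Z l ω = a l ∧ τ l ω ∈ A l ∧ ξ l ω ∈ C l} =
      ENNReal.ofReal (init (a 0)) *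
        (∏ l ∈ Finset.range m, ENNReal.ofReal (M (a l) (a (l + 1)))) *
        ∏ l ∈ Finset.range (m + 1), (wait (a l) (A l) * jump (a l) (C l))

/-- Number of jumps made up to time `t`: the `m`-th jump takes place at `τ 0 + ⋯ + τ m`. -/
def numJumps {Ω : Type*} (τ : ℕ → Ω → ℝ) (t : ℝ) (ω : Ω) : ℕ :=
  Set.ncard {m : ℕ | ∑ l ∈ Finset.range (m + 1), τ l ω ≤ t}

/-- Position at time `t` of the walk started at the origin. -/
def position {Ω : Type*} (τ ξ : ℕ → Ω → ℝ) (t : ℝ) (ω : Ω) : ℝ :=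
  ∑ l ∈ Finset.range (numJumps τ t ω), ξ l ω

/-- Fourier transform in space and Laplace transform in time of the law of the position. -/
def fourierLaplace {Ω : Type*} [MeasurableSpace Ω] (P : Measure Ω) (X : ℝ → Ω → ℝ)
    (k s : ℝ) : ℂ :=
  ∫ t in Set.Ioi (0 : ℝ), (Real.exp (-(s * t)) : ℂ) * charFun (P.map (X t)) k

/-- Mean squared displacement. -/
def msd {Ω : Type*} [MeasurableSpace Ω] (P : Measure Ω) (X : ℝ → Ω → ℝ) (t : ℝ) : ℝ :=
  ∫ ω, X t ω ^ 2 ∂P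

/-- Laplace transform of a function on the half line. -/
def laplace (f : ℝ → ℝ) (s : ℝ) : ℝ :=
  ∫ t in Set.Ioi (0 : ℝ), Real.exp (-(s * t)) * f t

/-- `μ` is the law of a positive waiting time which is an asymptotic power law:
its Laplace transform is `1 - B s ^ α` to leading order as `s → 0+`. -/
structure IsPowerLawWait (μ : Measure ℝ) (α B : ℝ) : Prop where
  isProbabilityMeasure : IsProbabilityMeasure μ
  pos : ∀ᵐ x ∂μ, 0 < x
  laplace_asymp : (fun s : ℝ => 1 - ∫ x, Real.exp (-(s * x)) ∂μ) ~[𝓝[>] 0]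
    fun s : ℝ => B * s ^ α

/-- Probability vectors. -/
def IsDistribution {S : Type*} [Fintype S] (v : S → ℝ) : Prop :=
  (∀ a, 0 ≤ v a) ∧ ∑ a, v a = 1

/-- Equilibrium (stationary) distributions of a transition matrix. -/
def IsEquilibrium {S : Type*} [Fintype S] (M : Matrix S S ℝ) (v : S → ℝ) : Prop :=
  IsDistribution v ∧ Matrix.vecMul v M = v

/-! In what follows there are `j` blocks, block `i` has `n i` states, and the internal states are
the pairs `⟨i, r⟩` with `r : Fin (n i)`. -/

/-- Internal states of a model with `j` blocks of sizes `n i`. -/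
abbrev State {j : ℕ} (n : Fin j → ℕ) : Type := (i : Fin j) × Fin (n i)

/-- Sum of the entries of block `i` of the vector `v`. -/
def blockSum {j : ℕ} {n : Fin j → ℕ} (v : State n → ℝ) (i : Fin j) : ℝ :=
  ∑ r : Fin (n i), v ⟨i, r⟩

/-- The blocks in which the initial distribution does not vanish identically. -/
def charged {j : ℕ} {n : Fin j → ℕ} (init : State n → ℝ) : Finset (Fin j) :=
  Finset.univ.filter fun i => ∃ r : Fin (n i), init ⟨i, r⟩ ≠ 0

/-- The sum of the entries of block `i` of `Ψ(s) eq`, where `Ψ(s)` is the diagonal matrix with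
entries `B a * s ^ α a`. -/
def psiSum {j : ℕ} {n : Fin j → ℕ} (α B eq : State n → ℝ) (s : ℝ) (i : Fin j) : ℝ :=
  blockSum (fun a => B a * s ^ α a * eq a) i

/-- Minimum of the exponents in block `i`. -/
def minExponent {j : ℕ} {n : Fin j → ℕ} (α : State n → ℝ) (i : Fin j) : ℝ :=
  ⨅ r : Fin (n i), α ⟨i, r⟩

/-- Maximum of the minimal exponents over the blocks charged by the initial distribution. -/
def alphaStar {j : ℕ} {n : Fin j → ℕ} (α init : State n → ℝ) : ℝ :=
  ⨆ i : {i : Fin j // i ∈ charged init}, minExponent α i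

/-- The coefficient of `t ^ alphaStar` in the mean squared displacement: only the charged blocks
with the largest minimal exponent contribute, and in them only the states with that exponent. -/
def msdCoeff {j : ℕ} {n : Fin j → ℕ} (α B eq init : State n → ℝ) (σ : ℝ) : ℝ :=
  (∑ i ∈ (charged init).filter fun i => minExponent α i = alphaStar α init,
    2 * σ ^ 2 * blockSum init i * blockSum eq i /
      ∑ r ∈ Finset.univ.filter fun r : Fin (n i) => α ⟨i, r⟩ = alphaStar α init,
        B ⟨i, r⟩ * eq ⟨i, r⟩) / Real.Gamma (1 + alphaStar α init)

end FCP

end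

/-! All jumps have the same Gaussian law whatever the state, so jumps are independent of waiting
times, and only the number of jumps made by time `t` matters. Let F_m be the distribution function
of the m-th jump time and q = exp(-σ²k²). Splitting by the number of jumps, the characteristic
function of the position is ∑ q^m (F_m - F_{m+1}), and the mean squared displacement is 2σ² times
the mean number of jumps, that is 2σ² ∑_{m ≥ 1} F_m. Let φ be the vector of waiting-time transforms
and Φ its diagonal matrix. The Laplace transform of F_m is λ(ΦM)^m 1 / s, so both quantities become
geometric-type series (`fourierLaplace_position`, `laplace_msd_position`).

Each series u solves u = f + (1 - E) M u with a small defect E: f = 1 - φ, E = 1 - qφ for the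
Fourier transform, and f = φ, E = 1 - φ for the mean number of jumps. Pairing with an equilibrium e
of an irreducible block gives ⟨e, f⟩ = ⟨e, E·Mu⟩. The equation also makes u almost subharmonic, so
irreducibility makes it constant on the block up to a relative error of the order of E. Hence u ~
⟨e, f⟩ / ⟨e, E⟩ (`isEquivalent_poisson`). This is a quantitative bound valid along any filter, so it
covers the joint limit in (k, s) with no relation between k and s. Inserting 1 - φ ~ B s^α and 1 - q
~ σ²k² and summing over the charged blocks, where no cancellation occurs as all terms are
nonnegative, yields the first two asymptotics.

For the third, the displacement is nondecreasing in time, so Karamata's theorem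
(`tendsto_div_rpow_of_laplace`) converts the behaviour of the transform at 0 into behaviour at
infinity. In a block the smallest exponent dominates ψ_i; among blocks the largest of these minima
dominates the sum. -/

namespace FCP

/-! ### Irreducible stochastic matrices and the defective Poisson equation. -/

section Matrix

variable {n : Type*} [Fintype n] [DecidableEq n] {M : Matrix n n ℝ}

lemma mulVec_apply_le (hM : M ∈ Matrix.rowStochastic ℝ n) {u : n → ℝ} {U : ℝ}
    (hu : ∀ c, u c ≤ U) (a : n) : (M.mulVec u) a ≤ U := by
  calc (M.mulVec u) a = ∑ c, M a c * u c := rfl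
    _ ≤ ∑ c, M a c * U := Finset.sum_le_sum fun c _ =>
        mul_le_mul_of_nonneg_left (hu c) (Matrix.nonneg_of_mem_rowStochastic hM)
    _ = U := by rw [← Finset.sum_mul, Matrix.sum_row_of_mem_rowStochastic hM, one_mul]

lemma le_mulVec_apply (hM : M ∈ Matrix.rowStochastic ℝ n) {u : n → ℝ} {U : ℝ}
    (hu : ∀ c, U ≤ u c) (a : n) : U ≤ (M.mulVec u) a := by
  calc U = ∑ c, M a c * U := by
        rw [← Finset.sum_mul, Matrix.sum_row_of_mem_rowStochastic hM, one_mul]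
    _ ≤ ∑ c, M a c * u c := Finset.sum_le_sum fun c _ =>
        mul_le_mul_of_nonneg_left (hu c) (Matrix.nonneg_of_mem_rowStochastic hM)

/-- Defects add up: u - M^(k+1) u = (u - Mu) + M(u - M^k u), and a stochastic matrix preserves upper
bounds. -/
lemma sub_pow_mulVec_le (hM : M ∈ Matrix.rowStochastic ℝ n) {u : n → ℝ} {r : ℝ}
    (h : ∀ c, u c - (M.mulVec u) c ≤ r) (k : ℕ) (a : n) :
    u a - ((M ^ k).mulVec u) a ≤ k * r := by
  induction k generalizing a with
  | zero => simp
  | succ k ih =>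
    have h1 := mulVec_apply_le hM (u := u - (M ^ k).mulVec u) (U := k * r) ih a
    rw [Matrix.mulVec_sub, Matrix.mulVec_mulVec, ← pow_succ'] at h1
    have h2 := h a
    simp only [Pi.sub_apply] at h1
    push_cast
    linarith

/-- A weak Harnack inequality: a function which is almost subharmonic for an irreducible stochastic
matrix is almost constant. -/
lemma exists_oscillation_bound (hM : M ∈ Matrix.rowStochastic ℝ n) (hirr : M.IsIrreducible) :
    ∃ K : ℝ, 0 ≤ K ∧ ∀ (u : n → ℝ) (r : ℝ) (a : n), 0 ≤ r → (∀ c, u c ≤ u a) →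
      (∀ c, u c - (M.mulVec u) c ≤ r) → ∀ b, u a - u b ≤ K * r := by
  choose k _ hk using (Matrix.isIrreducible_iff_exists_pow_pos hirr.nonneg).1 hirr
  have hpos : ∀ a b, 0 ≤ (k a b : ℝ) / (M ^ k a b) a b := fun a b =>
    div_nonneg (Nat.cast_nonneg _) (hk a b).le
  -- Summing over all pairs gives one constant that serves every starting point `a` and target `b`.
  refine ⟨∑ a, ∑ b, (k a b : ℝ) / (M ^ k a b) a b,
    Finset.sum_nonneg fun a _ => Finset.sum_nonneg fun b _ => hpos a b, ?_⟩
  intro u r a hr hU h b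
  have hMk : M ^ k a b ∈ Matrix.rowStochastic ℝ n := pow_mem hM _
  have h1 := sub_pow_mulVec_le hM h (k a b) a
  -- As `u a` is the maximum, every term of the averaged drop from `a` is nonnegative, so the single
  -- term at `b` is at most the whole average.
  have h2 : (M ^ k a b) a b * (u a - u b) ≤ u a - ((M ^ k a b).mulVec u) a := by
    calc (M ^ k a b) a b * (u a - u b) ≤ ∑ c, (M ^ k a b) a c * (u a - u c) :=
          Finset.single_le_sum (f := fun c => (M ^ k a b) a c * (u a - u c))
            (fun c _ => mul_nonneg (Matrix.nonneg_of_mem_rowStochastic hMk)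
              (sub_nonneg.2 (hU c))) (Finset.mem_univ b)
      _ = u a - ((M ^ k a b).mulVec u) a := by
          simp_rw [mul_sub]
          rw [Finset.sum_sub_distrib, ← Finset.sum_mul,
            Matrix.sum_row_of_mem_rowStochastic hMk, one_mul]
          rfl
  have h3 : u a - u b ≤ (k a b : ℝ) / (M ^ k a b) a b * r := by
    rw [div_mul_eq_mul_div, le_div_iff₀ (hk a b)]
    linarith
  refine h3.trans (mul_le_mul_of_nonneg_right ?_ hr)
  exact (Finset.single_le_sum (f := fun b => (k a b : ℝ) / (M ^ k a b) a b)
    (fun b _ => hpos a b) (Finset.mem_univ b)).trans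
    (Finset.single_le_sum (f := fun a => ∑ b, (k a b : ℝ) / (M ^ k a b) a b)
    (fun a _ => Finset.sum_nonneg fun b _ => hpos a b) (Finset.mem_univ a))

/-- Solutions of a slightly defective Poisson equation `u = f + (1 - E) M u` are nearly constant,
the constant being determined by the equilibrium distribution. -/
lemma exists_poisson_bound (hM : M ∈ Matrix.rowStochastic ℝ n) (hirr : M.IsIrreducible)
    {e : n → ℝ} (he : ∀ a, 0 < e a) (heM : Matrix.vecMul e M = e) :
    ∃ K : ℝ, 0 ≤ K ∧ ∀ (δ : ℝ) (u f E : n → ℝ), K * δ ≤ 1 / 2 → (∀ a, 0 ≤ u a) →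
      (∀ a, 0 ≤ f a) → (∀ a, 0 ≤ E a) → (∀ a, E a ≤ δ) →
      (∀ a, u a = f a + (1 - E a) * (M.mulVec u) a) →
      ∀ b, |u b * (∑ a, e a * E a) - ∑ a, e a * f a| ≤ 2 * (K * δ) * ∑ a, e a * f a := by
  obtain ⟨K, hK, hosc⟩ := exists_oscillation_bound hM hirr
  have hC0 : 0 ≤ ∑ a, (∑ c, e c) / e a := Finset.sum_nonneg fun a _ =>
    div_nonneg (Finset.sum_nonneg fun c _ => (he c).le) (he a).le
  set C := ∑ a, (∑ c, e c) / e a with hC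
  refine ⟨K * C, mul_nonneg hK hC0, ?_⟩
  intro δ u f E hδ hu hf hE hEδ hueq b
  obtain ⟨a, -, ha⟩ := Finset.exists_max_image Finset.univ u ⟨b, Finset.mem_univ b⟩
  replace ha : ∀ c, u c ≤ u a := fun c => ha c (Finset.mem_univ c)
  have hδ0 : 0 ≤ δ := (hE b).trans (hEδ b)
  have hMu : ∀ c, (M.mulVec u) c ≤ u a := mulVec_apply_le hM ha
  have hMu0 : ∀ c, 0 ≤ (M.mulVec u) c := le_mulVec_apply hM hu
  -- Pair the equation with `e`: stationarity cancels the undamped terms and leaves only the defect.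
  have hF : ∑ c, e c * f c = ∑ c, e c * E c * (M.mulVec u) c := by
    have h1 : ∑ c, e c * (M.mulVec u) c = ∑ c, e c * u c := by
      change e ⬝ᵥ M.mulVec u = e ⬝ᵥ u
      rw [Matrix.dotProduct_mulVec, heM]
    have h2 : ∑ c, e c * u c = ∑ c, e c * f c + ∑ c, e c * (M.mulVec u) c
        - ∑ c, e c * E c * (M.mulVec u) c := by
      rw [← Finset.sum_add_distrib, ← Finset.sum_sub_distrib]
      refine Finset.sum_congr rfl fun c _ => ?_
      rw [hueq c]; ring
    linarith
  have hFδ : ∑ c, e c * f c ≤ (∑ c, e c) * (δ * u a) := by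
    rw [hF, Finset.sum_mul]
    refine Finset.sum_le_sum fun c _ => ?_
    rw [mul_assoc]
    exact mul_le_mul_of_nonneg_left (mul_le_mul (hEδ c) (hMu c) (hMu0 c) hδ0) (he c).le
  -- The pairing controls only an `e`-average of `f`; dividing by `e c > 0` makes the bound
  -- pointwise, which is where `C` comes from. Since u - Mu ≤ f, the oscillation bound then applies
  -- with a defect proportional to δ max u.
  have hfb : ∀ c, f c ≤ C * (δ * u a) := by
    intro c
    have h1 : e c * f c ≤ (∑ c, e c) * (δ * u a) :=
      (Finset.single_le_sum (f := fun c => e c * f c)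
        (fun c _ => mul_nonneg (he c).le (hf c)) (Finset.mem_univ c)).trans hFδ
    have h2 : f c ≤ (∑ c, e c) / e c * (δ * u a) := by
      rw [div_mul_eq_mul_div, le_div_iff₀ (he c)]; linarith
    refine h2.trans (mul_le_mul_of_nonneg_right ?_ (mul_nonneg hδ0 (hu a)))
    exact Finset.single_le_sum (f := fun a => (∑ c, e c) / e a)
      (fun a _ => div_nonneg (Finset.sum_nonneg fun c _ => (he c).le) (he a).le)
      (Finset.mem_univ c)
  have hlow : ∀ c, u a - K * C * δ * u a ≤ u c := by
    intro c
    have := hosc u (C * (δ * u a)) a (mul_nonneg hC0 (mul_nonneg hδ0 (hu a))) ha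
      (fun c => by
        have h1 := hueq c
        have h2 := mul_nonneg (hE c) (hMu0 c)
        have h3 := hfb c
        linarith) c
    linarith
  have hlowM := le_mulVec_apply hM hlow
  have hA0 : 0 ≤ ∑ c, e c * E c := Finset.sum_nonneg fun c _ => mul_nonneg (he c).le (hE c)
  have hF1 : ∑ c, e c * f c ≤ (∑ c, e c * E c) * u a := by
    rw [hF, Finset.sum_mul]
    exact Finset.sum_le_sum fun c _ =>
      mul_le_mul_of_nonneg_left (hMu c) (mul_nonneg (he c).le (hE c))
  have hF2 : (∑ c, e c * E c) * (u a - K * C * δ * u a) ≤ ∑ c, e c * f c := by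
    rw [hF, Finset.sum_mul]
    exact Finset.sum_le_sum fun c _ =>
      mul_le_mul_of_nonneg_left (hlowM c) (mul_nonneg (he c).le (hE c))
  set A := ∑ c, e c * E c
  set F := ∑ c, e c * f c
  set t := K * C * δ
  have ht0 : 0 ≤ t := mul_nonneg (mul_nonneg hK hC0) hδ0
  have h1 : u b * A ≤ u a * A := mul_le_mul_of_nonneg_right (ha b) hA0
  have h2 : (u a - t * u a) * A ≤ u b * A := mul_le_mul_of_nonneg_right (hlow b) hA0
  -- Because `t ≤ 1/2`, the lower bound `hF2` can be absorbed, so the error is measured relative to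
  -- `F` and no longer to the unknown maximum of `u`.
  have h3 : A * u a ≤ 2 * F := by
    have : t * (A * u a) ≤ 1 / 2 * (A * u a) :=
      mul_le_mul_of_nonneg_right hδ (mul_nonneg hA0 (hu a))
    linarith
  have h4 : t * (A * u a) ≤ t * (2 * F) := mul_le_mul_of_nonneg_left h3 ht0
  rw [abs_le]
  constructor <;> linarith

/-- Asymptotics of the solutions of `u = f + (1 - E) M u` as the defect `E` tends to zero. -/
lemma isEquivalent_poisson (hM : M ∈ Matrix.rowStochastic ℝ n) (hirr : M.IsIrreducible)
    {e : n → ℝ} (he : ∀ a, 0 < e a) (heM : Matrix.vecMul e M = e)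
    {X : Type*} {l : Filter X} {u f E : X → n → ℝ} (hu : ∀ᶠ x in l, ∀ a, 0 ≤ u x a)
    (hf : ∀ᶠ x in l, ∀ a, 0 ≤ f x a) (hE : ∀ᶠ x in l, ∀ a, 0 ≤ E x a)
    (hE0 : ∀ a, Tendsto (fun x => E x a) l (𝓝 0))
    (hueq : ∀ᶠ x in l, ∀ a, u x a = f x a + (1 - E x a) * (M.mulVec (u x)) a) (b : n) :
    (fun x => u x b * ∑ a, e a * E x a) ~[l] fun x => ∑ a, e a * f x a := by
  obtain ⟨K, hK, h⟩ := exists_poisson_bound hM hirr he heM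
  have hδ : Tendsto (fun x => K * ∑ a, E x a) l (𝓝 0) := by
    simpa using (tendsto_finsetSum Finset.univ fun a _ => hE0 a).const_mul K
  have hδ2 : Tendsto (fun x => 2 * (K * ∑ a, E x a)) l (𝓝 0) := by
    simpa using hδ.const_mul 2
  refine Asymptotics.isLittleO_iff.2 fun c hc => ?_
  filter_upwards [hu, hf, hE, hueq, hδ.eventually_le_const (show (0:ℝ) < 1 / 2 by norm_num),
    hδ2.eventually_le_const hc] with x hu hf hE hueq h1 h2
  have h3 := h (∑ a, E x a) (u x) (f x) (E x) h1 hu hf hE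
    (fun a => Finset.single_le_sum (fun a _ => hE a) (Finset.mem_univ a)) hueq b
  have h4 : 0 ≤ ∑ a, e a * f x a := Finset.sum_nonneg fun a _ => mul_nonneg (he a).le (hf a)
  simp only [Pi.sub_apply, Real.norm_eq_abs]
  rw [abs_of_nonneg h4]
  exact h3.trans (mul_le_mul_of_nonneg_right h2 h4)

/-- M - 1 kills the constant vector, so it is singular and also has a left null vector v. The
triangle inequality gives |v| ≤ |v|M entrywise; both sides have the same total, hence they agree,
and |v| can be normalised. -/
lemma exists_stationary [Nonempty n] (hM : M ∈ Matrix.rowStochastic ℝ n) :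
    ∃ v : n → ℝ, (∀ a, 0 ≤ v a) ∧ ∑ a, v a = 1 ∧ Matrix.vecMul v M = v := by
  have hdet : (M - 1).det = 0 := by
    refine Matrix.exists_mulVec_eq_zero_iff.1 ⟨1, one_ne_zero, ?_⟩
    rw [Matrix.sub_mulVec, Matrix.one_vecMul_of_mem_rowStochastic hM, Matrix.one_mulVec, sub_self]
  obtain ⟨v, hv0, hv⟩ := Matrix.exists_vecMul_eq_zero_iff.2 hdet
  rw [Matrix.vecMul_sub, Matrix.vecMul_one, sub_eq_zero] at hv
  have hle : ∀ b ∈ Finset.univ, |v b| ≤ ∑ a, |v a| * M a b := by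
    intro b _
    calc |v b| = |∑ a, v a * M a b| := by
          conv_lhs => rw [← hv]
          rfl
      _ ≤ ∑ a, |v a * M a b| := Finset.abs_sum_le_sum_abs _ _
      _ = ∑ a, |v a| * M a b := Finset.sum_congr rfl fun a _ => by
          rw [abs_mul, abs_of_nonneg (Matrix.nonneg_of_mem_rowStochastic hM)]
  have hsum : ∑ b, |v b| = ∑ b, ∑ a, |v a| * M a b := by
    rw [Finset.sum_comm]
    refine Finset.sum_congr rfl fun a _ => ?_
    rw [← Finset.mul_sum, Matrix.sum_row_of_mem_rowStochastic hM, mul_one]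
  have heq := (Finset.sum_eq_sum_iff_of_le hle).1 hsum
  obtain ⟨c, hc⟩ := Function.ne_iff.1 hv0
  have hpos : 0 < ∑ a, |v a| := Finset.sum_pos' (fun a _ => abs_nonneg _)
    ⟨c, Finset.mem_univ c, abs_pos.2 hc⟩
  refine ⟨fun a => |v a| / ∑ a, |v a|, fun a => by positivity, ?_, ?_⟩
  · rw [← Finset.sum_div, div_self hpos.ne']
  · ext b
    rw [heq b (Finset.mem_univ b), Finset.sum_div]
    exact Finset.sum_congr rfl fun a _ => div_mul_eq_mul_div _ _ _

/-- Some entry is nonzero, and by irreducibility a power of `M` carries mass from it to any `b`. -/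
lemma stationary_pos (hirr : M.IsIrreducible) {v : n → ℝ} (hv0 : ∀ a, 0 ≤ v a)
    (hsum : ∑ a, v a ≠ 0) (hv : Matrix.vecMul v M = v) (b : n) : 0 < v b := by
  obtain ⟨a, -, ha⟩ := Finset.exists_ne_zero_of_sum_ne_zero hsum
  obtain ⟨k, -, hk⟩ := (Matrix.isIrreducible_iff_exists_pow_pos hirr.nonneg).1 hirr a b
  have hvk : Matrix.vecMul v (M ^ k) = v := by
    clear hk
    induction k with
    | zero => simp
    | succ k ih => rw [pow_succ, ← Matrix.vecMul_vecMul, ih, hv]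
  rw [← hvk]
  refine Finset.sum_pos' (fun c _ => mul_nonneg (hv0 c) (Matrix.pow_apply_nonneg hirr.nonneg k c b))
    ⟨a, Finset.mem_univ a, mul_pos (lt_of_le_of_ne (hv0 a) (Ne.symm ha)) hk⟩

end Matrix

/-! ### Block diagonal transition matrices. -/

section Blocks

variable {j : ℕ} {n : Fin j → ℕ} {M : (i : Fin j) → Matrix (Fin (n i)) (Fin (n i)) ℝ}

lemma blockDiagonal'_mulVec_apply (u : State n → ℝ) (i : Fin j) (r : Fin (n i)) :
    ((Matrix.blockDiagonal' M).mulVec u) ⟨i, r⟩ = ((M i).mulVec fun r => u ⟨i, r⟩) r := by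
  simp only [Matrix.mulVec, dotProduct]
  rw [Fintype.sum_sigma, Finset.sum_eq_single i]
  · simp
  · intro b _ hb
    exact Finset.sum_eq_zero fun c _ => by
      rw [Matrix.blockDiagonal'_apply_ne _ _ _ (Ne.symm hb), zero_mul]
  · simp

lemma vecMul_blockDiagonal'_apply (u : State n → ℝ) (i : Fin j) (r : Fin (n i)) :
    (Matrix.vecMul u (Matrix.blockDiagonal' M)) ⟨i, r⟩ =
      (Matrix.vecMul (fun r => u ⟨i, r⟩) (M i)) r := by
  simp only [Matrix.vecMul, dotProduct]
  rw [Fintype.sum_sigma, Finset.sum_eq_single i]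
  · simp
  · intro b _ hb
    exact Finset.sum_eq_zero fun c _ => by
      rw [Matrix.blockDiagonal'_apply_ne _ _ _ hb, mul_zero]
  · simp

lemma blockDiagonal'_mem_rowStochastic (hM : ∀ i, M i ∈ Matrix.rowStochastic ℝ (Fin (n i))) :
    Matrix.blockDiagonal' M ∈ Matrix.rowStochastic ℝ (State n) := by
  refine Matrix.mem_rowStochastic.2 ⟨?_, ?_⟩
  · rintro ⟨i, r⟩ ⟨i', r'⟩
    by_cases h : i = i'
    · subst h
      rw [Matrix.blockDiagonal'_apply_eq]
      exact Matrix.nonneg_of_mem_rowStochastic (hM i)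
    · rw [Matrix.blockDiagonal'_apply_ne _ _ _ h]
  · ext ⟨i, r⟩
    rw [blockDiagonal'_mulVec_apply]
    exact congrFun (Matrix.one_vecMul_of_mem_rowStochastic (hM i)) r

/-- Give the stationary vector of each block the weight 1/j. -/
lemma exists_equilibrium (hj : 0 < j) (hn : ∀ i, 0 < n i)
    (hM : ∀ i, M i ∈ Matrix.rowStochastic ℝ (Fin (n i))) :
    ∃ eq : State n → ℝ,
      IsEquilibrium (Matrix.blockDiagonal' M) eq ∧ ∀ i, blockSum eq i ≠ 0 := by
  have hne : ∀ i, Nonempty (Fin (n i)) := fun i => ⟨⟨0, hn i⟩⟩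
  choose v hv0 hv1 hv using fun i => exists_stationary (hM i)
  have hj' : (j : ℝ) ≠ 0 := by positivity
  refine ⟨fun a => v a.1 a.2 / j, ⟨⟨fun a => div_nonneg (hv0 _ _) (Nat.cast_nonneg _), ?_⟩, ?_⟩, ?_⟩
  · rw [Fintype.sum_sigma]
    simp_rw [← Finset.sum_div, hv1]
    simp [hj']
  · ext ⟨i, r⟩
    rw [vecMul_blockDiagonal'_apply]
    have := congrFun (hv i) r
    simp only [Matrix.vecMul, dotProduct] at this ⊢
    conv_rhs => rw [← this]
    rw [Finset.sum_div]
    exact Finset.sum_congr rfl fun c _ => div_mul_eq_mul_div _ _ _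
  · intro i
    simp only [blockSum]
    rw [← Finset.sum_div, hv1]
    positivity

lemma equilibrium_block {eq : State n → ℝ} (heq : IsEquilibrium (Matrix.blockDiagonal' M) eq)
    (i : Fin j) : Matrix.vecMul (fun r => eq ⟨i, r⟩) (M i) = fun r => eq ⟨i, r⟩ := by
  ext r
  rw [← vecMul_blockDiagonal'_apply, heq.2]

end Blocks

/-! ### Karamata's Tauberian theorem. -/

section Tauberian

/-- Pairing of `h (exp (-t))` with the density `exp (-t) * g t`. -/
noncomputable def expPairing (g h : ℝ → ℝ) : ℝ :=
  ∫ t in Set.Ioi (0 : ℝ), h (Real.exp (-t)) * (Real.exp (-t) * g t)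

lemma exp_neg_mem_Icc {t : ℝ} (ht : t ∈ Set.Ioi (0 : ℝ)) : Real.exp (-t) ∈ Set.Icc (0 : ℝ) 1 :=
  ⟨(Real.exp_pos _).le, Real.exp_le_one_iff.2 (neg_nonpos.2 (le_of_lt ht))⟩

lemma integrableOn_expPairing {g h : ℝ → ℝ} (hh : Continuous h)
    (hg : IntegrableOn (fun t => Real.exp (-t) * g t) (Set.Ioi 0)) :
    IntegrableOn (fun t => h (Real.exp (-t)) * (Real.exp (-t) * g t)) (Set.Ioi 0) := by
  obtain ⟨C, hC⟩ := isCompact_Icc.exists_bound_of_continuousOn (hh.continuousOn (s := Set.Icc 0 1))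
  refine Integrable.bdd_mul (c := C) hg ?_ ?_
  · exact (hh.comp (Real.continuous_exp.comp continuous_neg)).aestronglyMeasurable
  · filter_upwards [ae_restrict_mem measurableSet_Ioi] with t ht
    exact hC _ (exp_neg_mem_Icc ht)

lemma abs_expPairing_sub_le {g h p : ℝ → ℝ} (hh : Continuous h) (hp : Continuous p)
    (hg : IntegrableOn (fun t => Real.exp (-t) * g t) (Set.Ioi 0)) (hg0 : ∀ t, 0 < t → 0 ≤ g t)
    {ε : ℝ} (hε : ∀ x ∈ Set.Icc (0 : ℝ) 1, |p x - h x| ≤ ε) :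
    |expPairing g p - expPairing g h| ≤ ε * expPairing g fun _ => 1 := by
  rw [expPairing, expPairing, expPairing, ← integral_sub (integrableOn_expPairing hp hg)
    (integrableOn_expPairing hh hg), ← integral_const_mul]
  rw [← Real.norm_eq_abs]
  refine norm_integral_le_of_norm_le
    ((integrableOn_expPairing (h := fun _ => 1) continuous_const hg).const_mul ε) ?_
  filter_upwards [ae_restrict_mem measurableSet_Ioi] with t ht
  have h0 : 0 ≤ Real.exp (-t) * g t := mul_nonneg (Real.exp_pos _).le (hg0 t ht)
  rw [← sub_mul, Real.norm_eq_abs, abs_mul, abs_of_nonneg h0, one_mul]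
  exact mul_le_mul_of_nonneg_right (hε _ (exp_neg_mem_Icc ht)) h0

lemma tendsto_expPairing_polynomial {X : Type*} {l : Filter X} {g : X → ℝ → ℝ} {g₀ : ℝ → ℝ}
    (hg : ∀ᶠ x in l, IntegrableOn (fun t => Real.exp (-t) * g x t) (Set.Ioi 0))
    (hg₀ : IntegrableOn (fun t => Real.exp (-t) * g₀ t) (Set.Ioi 0))
    (h : ∀ m : ℕ, Tendsto (fun x => expPairing (g x) fun y => y ^ m) l
      (𝓝 (expPairing g₀ fun y => y ^ m))) (p : Polynomial ℝ) :
    Tendsto (fun x => expPairing (g x) fun y => p.eval y) l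
      (𝓝 (expPairing g₀ fun y => p.eval y)) := by
  induction p using Polynomial.induction_on' with
  | add p q hp hq =>
    have key : ∀ {k : ℝ → ℝ}, IntegrableOn (fun t => Real.exp (-t) * k t) (Set.Ioi 0) →
        expPairing k (fun y => (p + q).eval y) =
          expPairing k (fun y => p.eval y) + expPairing k (fun y => q.eval y) := by
      intro k hk
      rw [expPairing, expPairing, expPairing, ← integral_add
        (integrableOn_expPairing p.continuous hk) (integrableOn_expPairing q.continuous hk)]
      simp_rw [Polynomial.eval_add, add_mul]
    rw [key hg₀]
    refine (hp.add hq).congr' ?_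
    filter_upwards [hg] with x hx
    exact (key hx).symm
  | monomial m a =>
    have key : ∀ k : ℝ → ℝ, expPairing k (fun y => (Polynomial.monomial m a).eval y) =
        a * expPairing k fun y => y ^ m := by
      intro k
      rw [expPairing, expPairing, ← integral_const_mul]
      simp_rw [Polynomial.eval_monomial, mul_assoc]
    simp_rw [key]
    exact (h m).const_mul a

/-- Weierstrass approximation on [0, 1] in the variable y = exp(-t): convergence of all moments,
with nonnegative densities of bounded mass, extends to continuous test functions. -/
lemma tendsto_expPairing {X : Type*} {l : Filter X} {g : X → ℝ → ℝ} {g₀ : ℝ → ℝ}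
    (hg : ∀ᶠ x in l, IntegrableOn (fun t => Real.exp (-t) * g x t) (Set.Ioi 0))
    (hgnn : ∀ᶠ x in l, ∀ t, 0 < t → 0 ≤ g x t)
    (hg₀ : IntegrableOn (fun t => Real.exp (-t) * g₀ t) (Set.Ioi 0))
    (hg₀nn : ∀ t, 0 < t → 0 ≤ g₀ t)
    (h : ∀ m : ℕ, Tendsto (fun x => expPairing (g x) fun y => y ^ m) l
      (𝓝 (expPairing g₀ fun y => y ^ m))) {k : ℝ → ℝ} (hk : Continuous k) :
    Tendsto (fun x => expPairing (g x) k) l (𝓝 (expPairing g₀ k)) := by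
  rw [Metric.tendsto_nhds]
  intro η hη
  have hone : Tendsto (fun x => expPairing (g x) fun _ => 1) l
      (𝓝 (expPairing g₀ fun _ => 1)) := by simpa using h 0
  have hM0 : 0 ≤ expPairing g₀ fun _ => 1 := by
    refine setIntegral_nonneg measurableSet_Ioi fun t ht => ?_
    rw [one_mul]
    exact mul_nonneg (Real.exp_pos _).le (hg₀nn t ht)
  -- One more than the limiting mass: positive even if that mass is zero, and eventually a bound for
  -- the masses of `g x`.
  set M := (expPairing g₀ fun _ => 1) + 1 with hM
  have hMpos : 0 < M := by linarith
  obtain ⟨p, hp⟩ := exists_polynomial_near_of_continuousOn 0 1 k hk.continuousOn (η / (3 * M))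
    (by positivity)
  have hp' : ∀ x ∈ Set.Icc (0 : ℝ) 1, |p.eval x - k x| ≤ η / (3 * M) := fun x hx => (hp x hx).le
  have hpt := Metric.tendsto_nhds.1 (tendsto_expPairing_polynomial hg hg₀ h p) (η / 3)
    (by positivity)
  filter_upwards [hg, hgnn, hpt, hone.eventually_le_const (show _ < M by linarith)]
    with x hx1 hx2 hx3 hx4
  have h1 := abs_expPairing_sub_le hk p.continuous hx1 hx2 hp'
  have h2 := abs_expPairing_sub_le hk p.continuous hg₀ hg₀nn hp'
  have h3 : η / (3 * M) * (expPairing (g x) fun _ => 1) ≤ η / 3 := by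
    calc _ ≤ η / (3 * M) * M := mul_le_mul_of_nonneg_left hx4 (by positivity)
      _ = η / 3 := by field_simp
  have h4 : η / (3 * M) * (expPairing g₀ fun _ => 1) < η / 3 := by
    calc _ < η / (3 * M) * M := mul_lt_mul_of_pos_left (by linarith) (by positivity)
      _ = η / 3 := by field_simp
  rw [Real.dist_eq] at hx3 ⊢
  have h5 := abs_lt.1 hx3
  have h6 := abs_le.1 (h1.trans h3)
  have h7 := abs_lt.1 (h2.trans_lt h4)
  rw [abs_lt]
  constructor <;> linarith

/-- A bump function whose pull-back under `t ↦ exp (-t)` is supported in `[b, c]`. -/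
noncomputable def expBump (b c x : ℝ) : ℝ := max 0 ((x - Real.exp (-c)) * (Real.exp (-b) - x))

lemma continuous_expBump (b c : ℝ) : Continuous (expBump b c) := by
  unfold expBump; fun_prop

lemma expBump_nonneg (b c x : ℝ) : 0 ≤ expBump b c x := le_max_left _ _

lemma expBump_eq_zero {b c t : ℝ} (hbc : b ≤ c) (ht : t ∉ Set.Icc b c) :
    expBump b c (Real.exp (-t)) = 0 := by
  have h0 : Real.exp (-c) ≤ Real.exp (-b) := Real.exp_le_exp.2 (by linarith)
  refine max_eq_left ?_
  by_cases hb : b ≤ t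
  · have hc : c < t := by
      by_contra hc
      exact ht ⟨hb, not_lt.1 hc⟩
    have h1 : Real.exp (-t) < Real.exp (-c) := Real.exp_lt_exp.2 (by linarith)
    nlinarith
  · have h1 : Real.exp (-b) < Real.exp (-t) := Real.exp_lt_exp.2 (by linarith)
    nlinarith

lemma expPairing_one_expBump_pos {b c : ℝ} (hb : 0 < b) (hbc : b < c) :
    0 < expPairing (fun _ => 1) (expBump b c) := by
  have hint : IntegrableOn (fun t : ℝ => Real.exp (-t) * 1) (Set.Ioi 0) := by
    simpa using integrableOn_exp_neg_Ioi 0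
  rw [expPairing, setIntegral_pos_iff_support_of_nonneg_ae]
  · refine lt_of_lt_of_le ?_ (measure_mono (s := Set.Ioo b c) ?_)
    · simp [hbc]
    · intro t ht
      refine ⟨?_, hb.trans ht.1⟩
      have h1 : Real.exp (-t) < Real.exp (-b) := Real.exp_lt_exp.2 (by linarith [ht.1])
      have h2 : Real.exp (-c) < Real.exp (-t) := Real.exp_lt_exp.2 (by linarith [ht.2])
      have h3 : 0 < expBump b c (Real.exp (-t)) :=
        lt_max_of_lt_right (mul_pos (by linarith) (by linarith))
      have h4 := Real.exp_pos (-t)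
      exact (by positivity :
        0 < expBump b c (Real.exp (-t)) * (Real.exp (-t) * 1)).ne'
  · exact Eventually.of_forall fun t => mul_nonneg (expBump_nonneg _ _ _) (by positivity)
  · exact integrableOn_expPairing (continuous_expBump b c) hint

/-- On the support of the bump a monotone `g` lies between `g b` and `g c`. Averages against a
continuous function thus control pointwise values, and no discontinuous test function is needed. -/
lemma expPairing_expBump_mem {g : ℝ → ℝ} {b c : ℝ} (hb : 0 < b) (hbc : b < c)
    (hg : IntegrableOn (fun t => Real.exp (-t) * g t) (Set.Ioi 0))
    (hmono : MonotoneOn g (Set.Ioi 0)) :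
    g b * expPairing (fun _ => 1) (expBump b c) ≤ expPairing g (expBump b c) ∧
      expPairing g (expBump b c) ≤ g c * expPairing (fun _ => 1) (expBump b c) := by
  have hint : IntegrableOn (fun t : ℝ => Real.exp (-t) * 1) (Set.Ioi 0) := by
    simpa using integrableOn_exp_neg_Ioi 0
  have hc : 0 < c := hb.trans hbc
  have h1 := integrableOn_expPairing (continuous_expBump b c) hg
  have h2 := integrableOn_expPairing (continuous_expBump b c) hint
  simp only [expPairing, ← integral_const_mul]
  constructor
  · refine setIntegral_mono_on (h2.const_mul _) h1 measurableSet_Ioi fun t ht => ?_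
    by_cases htb : t ∈ Set.Icc b c
    · have := hmono hb ht htb.1
      have h3 := mul_nonneg (expBump_nonneg b c (Real.exp (-t))) (Real.exp_pos (-t)).le
      nlinarith
    · simp [expBump_eq_zero hbc.le htb]
  · refine setIntegral_mono_on h1 (h2.const_mul _) measurableSet_Ioi fun t ht => ?_
    by_cases htb : t ∈ Set.Icc b c
    · have := hmono ht hc htb.2
      have h3 := mul_nonneg (expBump_nonneg b c (Real.exp (-t))) (Real.exp_pos (-t)).le
      nlinarith
    · simp [expBump_eq_zero hbc.le htb]

/-- The factor `exp (-t)` in the pairing shifts the frequency from `m` to `m + 1`, which keeps it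
positive for m = 0. -/
lemma expPairing_pow (g : ℝ → ℝ) (m : ℕ) :
    expPairing g (fun y => y ^ m) = laplace g (m + 1) := by
  refine setIntegral_congr_fun measurableSet_Ioi fun t _ => ?_
  change Real.exp (-t) ^ m * (Real.exp (-t) * g t) = _
  rw [← mul_assoc, ← pow_succ, ← Real.exp_nat_mul]
  congr 2
  push_cast
  ring

lemma laplace_scale (f : ℝ → ℝ) (C s : ℝ) {T : ℝ} (hT : 0 < T) :
    laplace (fun t => f (T * t) / C) s = (laplace f (s / T) / T) / C := by
  have h := integral_comp_mul_left_Ioi (fun t => Real.exp (-(s / T * t)) * f t) 0 hT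
  rw [mul_zero, smul_eq_mul] at h
  simp only [laplace]
  rw [div_eq_inv_mul (∫ t in Set.Ioi (0 : ℝ), Real.exp (-(s / T * t)) * f t) T, ← h,
    ← integral_div]
  refine setIntegral_congr_fun measurableSet_Ioi fun t _ => ?_
  change Real.exp (-(s * t)) * (f (T * t) / C) = Real.exp (-(s / T * (T * t))) * f (T * t) / C
  rw [mul_div_assoc, show s / T * (T * t) = s * t by field_simp]

lemma integrableOn_exp_mul_rpow {a s : ℝ} (ha : 0 < a) (hs : 0 < s) :
    IntegrableOn (fun t : ℝ => Real.exp (-(s * t)) * t ^ a) (Set.Ioi 0) := by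
  have := integrableOn_rpow_mul_exp_neg_mul_rpow (p := 1) (s := a) (b := s) (by linarith)
    (by norm_num) hs
  refine this.congr_fun (fun t _ => ?_) measurableSet_Ioi
  change t ^ a * Real.exp (-s * t ^ (1 : ℝ)) = _
  rw [Real.rpow_one, mul_comm, neg_mul]

lemma laplace_rpow {a s : ℝ} (ha : 0 < a) (hs : 0 < s) :
    laplace (fun t => t ^ a) s = Real.Gamma (1 + a) / s ^ (1 + a) := by
  have h := Real.integral_rpow_mul_exp_neg_mul_Ioi (a := 1 + a) (r := s) (by linarith) hs
  rw [add_sub_cancel_left] at h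
  simp only [laplace]
  simp_rw [mul_comm (Real.exp _)]
  rw [h, Real.div_rpow zero_le_one hs.le, Real.one_rpow]
  ring

/-- **Karamata's Tauberian theorem** for monotone functions. -/
theorem tendsto_div_rpow_of_laplace {f : ℝ → ℝ} (hf0 : ∀ t, 0 < t → 0 ≤ f t)
    (hmono : MonotoneOn f (Set.Ioi 0))
    (hint : ∀ s, 0 < s → IntegrableOn (fun t => Real.exp (-(s * t)) * f t) (Set.Ioi 0))
    {A a : ℝ} (hA : 0 ≤ A) (ha : 0 < a)
    (h : Tendsto (fun s => s ^ (1 + a) * laplace f s) (𝓝[>] 0) (𝓝 (A * Real.Gamma (1 + a)))) :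
    Tendsto (fun t => f t / t ^ a) atTop (𝓝 A) := by
  -- Rescaling turns the claim into g T 1 → A, with limiting profile t^a A.
  set g : ℝ → ℝ → ℝ := fun T t => f (T * t) / T ^ a with hg
  set g₀ : ℝ → ℝ := fun t => t ^ a * A with hg₀
  have hgi : ∀ᶠ T in atTop, IntegrableOn (fun t => Real.exp (-t) * g T t) (Set.Ioi 0) := by
    filter_upwards [eventually_gt_atTop 0] with T hT
    have h1 := (integrableOn_Ioi_comp_mul_left_iff
      (fun t => Real.exp (-(1 / T * t)) * f t) 0 hT).2 (by simpa using hint (1 / T) (by positivity))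
    refine IntegrableOn.congr_fun (Integrable.div_const h1 (T ^ a)) (fun t _ => ?_)
      measurableSet_Ioi
    change Real.exp (-(1 / T * (T * t))) * f (T * t) / T ^ a = _
    rw [show 1 / T * (T * t) = t by field_simp, mul_div_assoc]
  have hgnn : ∀ᶠ T in atTop, ∀ t, 0 < t → 0 ≤ g T t := by
    filter_upwards [eventually_gt_atTop 0] with T hT t ht
    exact div_nonneg (hf0 _ (by positivity)) (by positivity)
  have hgmono : ∀ᶠ T in atTop, MonotoneOn (g T) (Set.Ioi 0) := by
    filter_upwards [eventually_gt_atTop 0] with T hT x hx y hy hxy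
    exact div_le_div_of_nonneg_right (hmono (mul_pos hT hx) (mul_pos hT hy)
      (mul_le_mul_of_nonneg_left hxy hT.le)) (by positivity)
  have hg₀i : IntegrableOn (fun t => Real.exp (-t) * g₀ t) (Set.Ioi 0) := by
    have := Integrable.mul_const (integrableOn_exp_mul_rpow ha one_pos) A
    simpa [hg₀, mul_assoc, IntegrableOn] using this
  have hg₀nn : ∀ t, 0 < t → 0 ≤ g₀ t := fun t ht => mul_nonneg (by positivity) hA
  have hg₀mono : MonotoneOn g₀ (Set.Ioi 0) := fun x hx y _ hxy =>
    mul_le_mul_of_nonneg_right (Real.rpow_le_rpow (le_of_lt hx) hxy ha.le) hA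
  -- By scaling, the m-th moment of `g T` is the transform of `f` at (m + 1)/T divided by T^(1+a),
  -- so the hypothesis at 0+ gives its limit.
  have hmom : ∀ m : ℕ, Tendsto (fun T => expPairing (g T) fun y => y ^ m) atTop
      (𝓝 (expPairing g₀ fun y => y ^ m)) := by
    intro m
    have hm : (0 : ℝ) < m + 1 := by positivity
    have hlim : Tendsto (fun T : ℝ => ((m : ℝ) + 1) / T) atTop (𝓝[>] 0) :=
      tendsto_nhdsWithin_iff.2 ⟨tendsto_const_nhds.div_atTop tendsto_id,
        (eventually_gt_atTop 0).mono fun T hT => div_pos hm hT⟩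
    have h1 := (h.comp hlim).div_const (((m : ℝ) + 1) ^ (1 + a))
    have h2 : expPairing g₀ (fun y => y ^ m) =
        A * Real.Gamma (1 + a) / ((m : ℝ) + 1) ^ (1 + a) := by
      rw [expPairing_pow, mul_div_assoc, ← laplace_rpow ha hm]
      simp only [laplace, hg₀]
      rw [← integral_const_mul]
      exact integral_congr_ae (Eventually.of_forall fun t => by ring)
    rw [h2]
    refine h1.congr' ?_
    filter_upwards [eventually_gt_atTop 0] with T hT
    rw [expPairing_pow, hg, laplace_scale f _ _ hT]
    simp only [Function.comp]
    rw [Real.div_rpow hm.le hT.le, Real.rpow_add hT, Real.rpow_one]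
    have : (0 : ℝ) < ((m : ℝ) + 1) ^ (1 + a) := by positivity
    have : 0 < T ^ a := by positivity
    field_simp
  -- Sandwich the averages of `g T` and of the limit between their values at `b` and `c`; a slack of
  -- `η * W` becomes `η` after division by the mass `W` of the bump.
  have hconv : ∀ b c : ℝ, 0 < b → b < c → ∀ η > 0, ∀ᶠ T in atTop,
      g T b ≤ c ^ a * A + η ∧ b ^ a * A - η ≤ g T c := by
    intro b c hb hbc η hη
    have hW := expPairing_one_expBump_pos hb hbc
    set W := expPairing (fun _ => 1) (expBump b c)
    have ht := tendsto_expPairing hgi hgnn hg₀i hg₀nn hmom (continuous_expBump b c)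
    have h0 := expPairing_expBump_mem hb hbc hg₀i hg₀mono
    have hηW : 0 < η * W := mul_pos hη hW
    filter_upwards [hgi, hgmono, ht.eventually_le_const
        (show _ < expPairing g₀ (expBump b c) + η * W by linarith),
      ht.eventually_const_le
        (show expPairing g₀ (expBump b c) - η * W < _ by linarith)] with T h1 h2 h3 h4
    have h5 := expPairing_expBump_mem hb hbc h1 h2
    constructor
    · refine le_of_mul_le_mul_right ?_ hW
      have := h0.2
      simp only [hg₀] at this h3
      linarith [h5.1]
    · refine le_of_mul_le_mul_right ?_ hW
      have := h0.1
      simp only [hg₀] at this h4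
      linarith [h5.2]
  have hcont : ContinuousAt (fun x : ℝ => x ^ a * A) 1 :=
    (Real.continuousAt_rpow_const 1 a (Or.inl one_ne_zero)).mul_const A
  have hcont' : Tendsto (fun x : ℝ => x ^ a * A) (𝓝 1) (𝓝 A) := by
    simpa [ContinuousAt] using hcont
  have hgT : ∀ T, g T 1 = f T / T ^ a := fun T => by simp [hg]
  -- Put 1 at one end of the interval and let the other end approach it, using continuity of x^a A
  -- at 1.
  rw [tendsto_order]
  constructor
  · intro u hu
    obtain ⟨b, hb1, hb2, hb0⟩ := (((hcont'.mono_left nhdsWithin_le_nhds).eventually_const_lt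
      (show (u + A) / 2 < A by linarith)).and (Ioo_mem_nhdsLT (show (0 : ℝ) < 1 by norm_num))).exists
    filter_upwards [hconv b 1 hb2 hb0 ((A - u) / 4) (by linarith)] with T hT
    rw [← hgT]
    linarith [hT.2]
  · intro u hu
    obtain ⟨c, hc1, hc2⟩ := (((hcont'.mono_left nhdsWithin_le_nhds).eventually_lt_const
      (show A < (u + A) / 2 by linarith)).and self_mem_nhdsWithin : ∀ᶠ c in 𝓝[>] (1:ℝ), _).exists
    filter_upwards [hconv 1 c one_pos hc2 ((u - A) / 4) (by linarith)] with T hT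
    rw [← hgT]
    linarith [hT.1]

end Tauberian

/-! ### Joint law of waiting times and jumps. -/

section PathLaw

variable {Ω S : Type*} [MeasurableSpace Ω] {P : Measure Ω}
  {init : S → ℝ} {M : Matrix S S ℝ} {wait : S → Measure ℝ} {γ : Measure ℝ}
  {Z : ℕ → Ω → S} {τ ξ : ℕ → Ω → ℝ}

/-- Probability that the first `m + 1` internal states are `a`. -/
noncomputable def pathWeight (init : S → ℝ) (M : Matrix S S ℝ) (m : ℕ) (a : Fin (m + 1) → S) :
    ENNReal :=
  ENNReal.ofReal (init (a 0)) * ∏ l : Fin m, ENNReal.ofReal (M (a l.castSucc) (a l.succ))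

lemma pathWeight_ne_top (m : ℕ) (a : Fin (m + 1) → S) : pathWeight init M m a ≠ ⊤ :=
  ENNReal.mul_ne_top ENNReal.ofReal_ne_top
    (ENNReal.prod_ne_top fun _ _ => ENNReal.ofReal_ne_top)

lemma measure_path (h : IsInternalStateWalk P init M wait (fun _ => γ) Z τ ξ) (m : ℕ)
    (a : Fin (m + 1) → S) {A C : Fin (m + 1) → Set ℝ} (hA : ∀ l, MeasurableSet (A l))
    (hC : ∀ l, MeasurableSet (C l)) :
    P {ω | ∀ l : Fin (m + 1), Z l ω = a l ∧ τ l ω ∈ A l ∧ ξ l ω ∈ C l} =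
      pathWeight init M m a * (∏ l, wait (a l) (A l)) * ∏ l, γ (C l) := by
  -- `Fin.ofNat` wraps indices modulo `m + 1`, which is harmless because only indices up to `m`
  -- enter.
  have hl := h.law m (fun l => a (Fin.ofNat (m + 1) l)) (fun l => A (Fin.ofNat (m + 1) l))
    (fun l => C (Fin.ofNat (m + 1) l)) (fun l => hA _) fun l => hC _
  have hset : {ω | ∀ l : Fin (m + 1), Z l ω = a l ∧ τ l ω ∈ A l ∧ ξ l ω ∈ C l} =
      {ω | ∀ l ≤ m, Z l ω = a (Fin.ofNat (m + 1) l) ∧ τ l ω ∈ A (Fin.ofNat (m + 1) l) ∧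
        ξ l ω ∈ C (Fin.ofNat (m + 1) l)} := by
    ext ω
    constructor
    · intro hω l hlm
      have hl' : l < m + 1 := by omega
      have := hω (Fin.ofNat (m + 1) l)
      simpa [Fin.ofNat, Nat.mod_eq_of_lt hl'] using this
    · intro hω l
      have := hω l (by omega)
      simpa [Fin.ofNat, Nat.mod_eq_of_lt l.2] using this
  rw [hset, hl, Finset.prod_range, Finset.prod_range, Finset.prod_mul_distrib, ← mul_assoc]
  have e1 : ∀ l : Fin (m + 1), Fin.ofNat (m + 1) (l : ℕ) = l := fun l => by
    ext; simp [Fin.ofNat, Nat.mod_eq_of_lt l.2]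
  have e2 : ∀ l : Fin m, Fin.ofNat (m + 1) (l : ℕ) = l.castSucc := fun l => e1 l.castSucc
  have e3 : ∀ l : Fin m, Fin.ofNat (m + 1) ((l : ℕ) + 1) = l.succ := fun l => e1 l.succ
  simp_rw [e1, e2, e3]
  rfl

variable [Fintype S]

/-- Law of the first `m + 1` waiting times. -/
noncomputable def waitLaw (init : S → ℝ) (M : Matrix S S ℝ) (wait : S → Measure ℝ) (m : ℕ) :
    Measure (Fin (m + 1) → ℝ) :=
  ∑ a : Fin (m + 1) → S, pathWeight init M m a • Measure.pi fun l => wait (a l)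

instance [∀ a, IsProbabilityMeasure (wait a)] (m : ℕ) :
    IsFiniteMeasure (waitLaw init M wait m) := by
  refine ⟨?_⟩
  rw [waitLaw, Measure.finsetSum_apply]
  refine ENNReal.sum_lt_top.2 fun a _ => ?_
  simp only [Measure.smul_apply, smul_eq_mul, measure_univ, mul_one]
  exact (pathWeight_ne_top m a).lt_top

/-- Sum over all state paths. The jump factor is the same for every path since `γ` does not depend
on the state, so it leaves the sum: this is the source of the unconditional independence of waits
and jumps. -/
lemma measure_wait_jump (h : IsInternalStateWalk P init M wait (fun _ => γ) Z τ ξ) (m : ℕ)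
    [∀ a, IsProbabilityMeasure (wait a)] [IsProbabilityMeasure γ]
    {A C : Fin (m + 1) → Set ℝ} (hA : ∀ l, MeasurableSet (A l)) (hC : ∀ l, MeasurableSet (C l)) :
    P {ω | (∀ l : Fin (m + 1), τ l ω ∈ A l) ∧ ∀ l : Fin (m + 1), ξ l ω ∈ C l} =
      waitLaw init M wait m (Set.univ.pi A) * Measure.pi (fun _ => γ) (Set.univ.pi C) := by
  have hset : {ω | (∀ l : Fin (m + 1), τ l ω ∈ A l) ∧ ∀ l : Fin (m + 1), ξ l ω ∈ C l} =
      ⋃ a : Fin (m + 1) → S,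
        {ω | ∀ l : Fin (m + 1), Z l ω = a l ∧ τ l ω ∈ A l ∧ ξ l ω ∈ C l} := by
    ext ω
    simp only [Set.mem_ofPred_eq, Set.mem_iUnion]
    constructor
    · rintro ⟨h1, h2⟩
      exact ⟨fun l => Z l ω, fun l => ⟨rfl, h1 l, h2 l⟩⟩
    · rintro ⟨a, ha⟩
      exact ⟨fun l => (ha l).2.1, fun l => (ha l).2.2⟩
  rw [hset, measure_iUnion]
  · rw [tsum_fintype, waitLaw, Measure.finsetSum_apply, Finset.sum_mul]
    refine Finset.sum_congr rfl fun a _ => ?_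
    rw [measure_path h m a hA hC, Measure.smul_apply, Measure.pi_pi, Measure.pi_pi, smul_eq_mul]
  · intro a b hab
    refine Set.disjoint_left.2 fun ω ha hb => hab ?_
    ext l
    exact (ha l).1.symm.trans (hb l).1
  · intro a
    have : {ω | ∀ l : Fin (m + 1), Z l ω = a l ∧ τ l ω ∈ A l ∧ ξ l ω ∈ C l} =
        ⋂ l : Fin (m + 1), ({ω | Z l ω = a l} ∩ (τ l ⁻¹' A l ∩ ξ l ⁻¹' C l)) := by
      ext ω; simp
    rw [this]
    exact MeasurableSet.iInter fun l => (h.measurableSet_state l (a l)).inter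
      ((h.measurable_wait l (hA l)).inter (h.measurable_jump l (hC l)))

/-- A finite measure is spanned by the box `univ`. -/
noncomputable def finiteSpanningSetsInBoxes {ι : Type*} (μ : Measure (ι → ℝ)) [IsFiniteMeasure μ] :
    μ.FiniteSpanningSetsIn (Set.univ.pi '' Set.univ.pi fun _ : ι => {s : Set ℝ | MeasurableSet s}) where
  set _ := Set.univ
  set_mem _ := ⟨fun _ => Set.univ, by simp, Set.pi_univ _⟩
  finite _ := measure_lt_top _ _
  spanning := Set.iUnion_const _

lemma map_wait_jump (h : IsInternalStateWalk P init M wait (fun _ => γ) Z τ ξ) (m : ℕ)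
    [∀ a, IsProbabilityMeasure (wait a)] [IsProbabilityMeasure γ] :
    P.map (fun ω => ((fun l : Fin (m + 1) => τ l ω), fun l : Fin (m + 1) => ξ l ω)) =
      (waitLaw init M wait m).prod (Measure.pi fun _ => γ) := by
  have hτ := h.measurable_wait
  have hξ := h.measurable_jump
  symm
  refine Measure.prod_eq_generateFrom generateFrom_pi generateFrom_pi isPiSystem_pi isPiSystem_pi
    (finiteSpanningSetsInBoxes _) (finiteSpanningSetsInBoxes _) ?_
  rintro _ ⟨A, hA, rfl⟩ _ ⟨C, hC, rfl⟩
  have hA' : ∀ l, MeasurableSet (A l) := fun l => hA l (Set.mem_univ l)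
  have hC' : ∀ l, MeasurableSet (C l) := fun l => hC l (Set.mem_univ l)
  rw [Measure.map_apply (by fun_prop) ((MeasurableSet.univ_pi hA').prod (MeasurableSet.univ_pi hC')),
    ← measure_wait_jump h m hA' hC']
  congr 1
  ext ω
  simp

lemma map_wait (h : IsInternalStateWalk P init M wait (fun _ => γ) Z τ ξ) (m : ℕ)
    [∀ a, IsProbabilityMeasure (wait a)] [IsProbabilityMeasure γ] :
    P.map (fun ω => fun l : Fin (m + 1) => τ l ω) = waitLaw init M wait m := by
  have hτ := h.measurable_wait
  have hξ := h.measurable_jump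
  have h1 := congrArg (Measure.map Prod.fst) (map_wait_jump h m)
  rw [Measure.map_map measurable_fst (by fun_prop), Measure.map_fst_prod, measure_univ,
    one_smul] at h1
  exact h1

lemma wait_pos (h : IsInternalStateWalk P init M wait (fun _ => γ) Z τ ξ)
    [∀ a, IsProbabilityMeasure (wait a)] [IsProbabilityMeasure γ]
    (hpos : ∀ a, ∀ᵐ x ∂wait a, 0 < x) : ∀ᵐ ω ∂P, ∀ l, 0 < τ l ω := by
  have hτ := h.measurable_wait
  refine ae_all_iff.2 fun l => ?_
  have h1 : ∀ᵐ x ∂waitLaw init M wait l, 0 < x (Fin.last l) := by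
    rw [waitLaw, ae_finsetSum_measure_iff]
    intro a _
    refine Measure.ae_smul_measure ?_ _
    exact (measurePreserving_eval (fun l => wait (a l)) (Fin.last l)).quasiMeasurePreserving.ae
      (hpos _)
  rw [← map_wait h] at h1
  simpa using ae_of_ae_map (by fun_prop) h1

variable [IsProbabilityMeasure P]

lemma waitLaw_univ (h : IsInternalStateWalk P init M wait (fun _ => γ) Z τ ξ) (m : ℕ)
    [∀ a, IsProbabilityMeasure (wait a)] [IsProbabilityMeasure γ] :
    waitLaw init M wait m Set.univ = 1 := by
  have h1 := measure_wait_jump h m (A := fun _ => Set.univ) (C := fun _ => Set.univ)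
    (fun _ => MeasurableSet.univ) fun _ => MeasurableSet.univ
  simpa using h1.symm

lemma map_jump (h : IsInternalStateWalk P init M wait (fun _ => γ) Z τ ξ) (m : ℕ)
    [∀ a, IsProbabilityMeasure (wait a)] [IsProbabilityMeasure γ] :
    P.map (fun ω => fun l : Fin (m + 1) => ξ l ω) = Measure.pi fun _ => γ := by
  have hτ := h.measurable_wait
  have hξ := h.measurable_jump
  have h1 := congrArg (Measure.map Prod.snd) (map_wait_jump h m)
  rw [Measure.map_map measurable_snd (by fun_prop), Measure.map_snd_prod, waitLaw_univ h,
    one_smul] at h1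
  exact h1

lemma indepFun_wait_jump (h : IsInternalStateWalk P init M wait (fun _ => γ) Z τ ξ) (m : ℕ)
    [∀ a, IsProbabilityMeasure (wait a)] [IsProbabilityMeasure γ] :
    IndepFun (fun ω => fun l : Fin (m + 1) => τ l ω) (fun ω => fun l : Fin (m + 1) => ξ l ω) P := by
  have hτ := h.measurable_wait
  have hξ := h.measurable_jump
  rw [indepFun_iff_map_prod_eq_prod_map_map (by fun_prop) (by fun_prop), map_wait h, map_jump h,
    map_wait_jump h]

end PathLaw

/-! ### Path sums as matrix iterates. -/

section Iterates

variable {S : Type*} [Fintype S] [DecidableEq S] {M : Matrix S S ℝ}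

/-- The iterates `(Φ M) ^ m 1`, where `Φ` is the diagonal matrix with entries `φ`. -/
noncomputable def iter (M : Matrix S S ℝ) (φ : S → ℝ) : ℕ → S → ℝ
  | 0 => 1
  | m + 1 => fun a => φ a * (M.mulVec (iter M φ m)) a

lemma iter_nonneg (hM : M ∈ Matrix.rowStochastic ℝ S) {φ : S → ℝ} (hφ : ∀ a, 0 ≤ φ a) (m : ℕ)
    (a : S) : 0 ≤ iter M φ m a := by
  induction m generalizing a with
  | zero => exact zero_le_one
  | succ m ih => exact mul_nonneg (hφ a) (le_mulVec_apply hM ih a)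

lemma iter_succ_le (hM : M ∈ Matrix.rowStochastic ℝ S) {φ : S → ℝ} (hφ : ∀ a, 0 ≤ φ a)
    (hφ1 : ∀ a, φ a ≤ 1) (m : ℕ) (a : S) : iter M φ (m + 1) a ≤ iter M φ m a := by
  induction m generalizing a with
  | zero =>
    refine mul_le_one₀ (hφ1 a) ?_ ?_
    · exact le_mulVec_apply hM (iter_nonneg hM hφ 0) a
    · exact mulVec_apply_le hM (fun c => le_rfl) a
  | succ m ih =>
    refine mul_le_mul_of_nonneg_left ?_ (hφ a)
    exact Finset.sum_le_sum fun c _ =>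
      mul_le_mul_of_nonneg_left (ih c) (Matrix.nonneg_of_mem_rowStochastic hM)

lemma iter_le_pow (hM : M ∈ Matrix.rowStochastic ℝ S) {φ : S → ℝ} (hφ : ∀ a, 0 ≤ φ a)
    {ρ : ℝ} (hρ : ∀ a, φ a ≤ ρ) (m : ℕ) (a : S) : iter M φ m a ≤ ρ ^ m := by
  induction m generalizing a with
  | zero => simp [iter]
  | succ m ih =>
    rw [pow_succ']
    exact mul_le_mul (hρ a) (mulVec_apply_le hM ih a)
      (le_mulVec_apply hM (iter_nonneg hM hφ m) a) ((hφ a).trans (hρ a))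

lemma iter_one (hM : M ∈ Matrix.rowStochastic ℝ S) (φ : S → ℝ) : iter M φ 1 = φ := by
  ext a
  change φ a * (M.mulVec 1) a = φ a
  rw [Matrix.one_vecMul_of_mem_rowStochastic hM, Pi.one_apply, mul_one]

/-- Induction by splitting off the first state and absorbing it into the weight `v`, which is why
`v` is arbitrary. There are `m + 1` factors `φ` but only `m` transitions; the last `M` in `iter`
acts on the constant 1 and disappears. -/
lemma sum_paths (hM : M ∈ Matrix.rowStochastic ℝ S) (φ : S → ℝ) (m : ℕ) (v : S → ℝ) :
    ∑ a : Fin (m + 1) → S, (v (a 0) * ∏ l : Fin m, M (a l.castSucc) (a l.succ)) *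
      ∏ l, φ (a l) = ∑ b, v b * iter M φ (m + 1) b := by
  induction m generalizing v with
  | zero =>
    rw [iter_one hM, ← (Equiv.funUnique (Fin 1) S).symm.sum_comp]
    refine Finset.sum_congr rfl fun b _ => ?_
    simp
  | succ m ih =>
    rw [← (Fin.consEquiv fun _ : Fin (m + 2) => S).sum_comp, Fintype.sum_prod_type]
    have hstep := ih fun c => ∑ b, v b * φ b * M b c
    have h2 : ∑ b, v b * iter M φ (m + 1 + 1) b =
        ∑ c, (∑ b, v b * φ b * M b c) * iter M φ (m + 1) c := by
      simp_rw [Finset.sum_mul]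
      rw [Finset.sum_comm]
      refine Finset.sum_congr rfl fun b _ => ?_
      simp only [iter, Matrix.mulVec, dotProduct]
      rw [← mul_assoc, Finset.mul_sum]
      simp_rw [mul_assoc]
    rw [h2, ← hstep, Finset.sum_comm]
    refine Finset.sum_congr rfl fun a _ => ?_
    rw [Finset.sum_mul, Finset.sum_mul]
    refine Finset.sum_congr rfl fun b _ => ?_
    rw [Fin.prod_univ_succ (n := m), Fin.prod_univ_succ (n := m + 1)]
    simp only [Fin.consEquiv_apply, Fin.cons_zero, Fin.cons_succ, Fin.castSucc_zero]
    simp only [← Fin.succ_castSucc, Fin.cons_succ]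
    ring

end Iterates

/-! ### Laplace transforms of waiting times. -/

section WaitLaplace

/-- Laplace transform of a law on the half line. -/
noncomputable def waitLaplace (μ : Measure ℝ) (s : ℝ) : ℝ := ∫ x, Real.exp (-(s * x)) ∂μ

variable {μ : Measure ℝ} [IsProbabilityMeasure μ]

lemma integrable_exp_neg_mul {Ω : Type*} [MeasurableSpace Ω] {P : Measure Ω} [IsFiniteMeasure P]
    {X : Ω → ℝ} (hX : Measurable X) (h0 : ∀ᵐ ω ∂P, 0 ≤ X ω) {s : ℝ} (hs : 0 ≤ s) :
    Integrable (fun ω => Real.exp (-(s * X ω))) P := by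
  refine Integrable.of_bound (by fun_prop) 1 ?_
  filter_upwards [h0] with ω hω
  rw [Real.norm_eq_abs, Real.abs_exp]
  exact Real.exp_le_one_iff.2 (neg_nonpos.2 (mul_nonneg hs hω))

lemma waitLaplace_nonneg (μ : Measure ℝ) (s : ℝ) : 0 ≤ waitLaplace μ s :=
  integral_nonneg fun _ => (Real.exp_pos _).le

lemma waitLaplace_lt_one (hμ : ∀ᵐ x ∂μ, 0 < x) {s : ℝ} (hs : 0 < s) : waitLaplace μ s < 1 := by
  have hi : Integrable (fun x => Real.exp (-(s * x))) μ :=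
    integrable_exp_neg_mul measurable_id (hμ.mono fun x hx => le_of_lt hx) hs.le
  have h1 : 0 < ∫ x, (1 - Real.exp (-(s * x))) ∂μ := by
    rw [integral_pos_iff_support_of_nonneg_ae (f := fun x => 1 - Real.exp (-(s * x))) _
      ((integrable_const 1).sub hi)]
    · rw [pos_iff_ne_zero]
      intro h0
      have h2 : ∀ᵐ x ∂μ, False := by
        filter_upwards [hμ, measure_eq_zero_iff_ae_notMem.1 h0] with x hx hx2
        refine hx2 (ne_of_gt (sub_pos.2 (Real.exp_lt_one_iff.2 ?_)))
        exact neg_lt_zero.2 (mul_pos hs hx)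
      exact h2.exists.choose_spec
    · filter_upwards [hμ] with x hx
      exact sub_nonneg.2 (Real.exp_le_one_iff.2 (neg_nonpos.2 (mul_pos hs hx).le))
  rw [integral_sub (integrable_const 1) hi] at h1
  simpa [waitLaplace] using h1

/-- Finitely many states give a uniform ratio below 1, the origin of all geometric bounds below. -/
lemma exists_waitLaplace_le {S : Type*} [Finite S] {wait : S → Measure ℝ}
    [∀ a, IsProbabilityMeasure (wait a)] (hpos : ∀ a, ∀ᵐ x ∂wait a, 0 < x) {s : ℝ} (hs : 0 < s) :
    ∃ ρ : ℝ, 0 ≤ ρ ∧ ρ < 1 ∧ ∀ a, waitLaplace (wait a) s ≤ ρ := by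
  rcases isEmpty_or_nonempty S with hS | hS
  · exact ⟨0, le_rfl, one_pos, fun a => hS.elim a⟩
  · obtain ⟨a, ha⟩ := Finite.exists_max fun a => waitLaplace (wait a) s
    exact ⟨_, waitLaplace_nonneg _ _, waitLaplace_lt_one (hpos a) hs, ha⟩

end WaitLaplace

/-! ### Jump times, number of jumps, and expectations along the walk. -/

section Arrivals

/-- Time of the `m`-th jump (counted from `1`), equal to `0` for `m = 0`. -/
def arrival {Ω : Type*} (τ : ℕ → Ω → ℝ) (m : ℕ) (ω : Ω) : ℝ := ∑ l ∈ Finset.range m, τ l ω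

/-- Distribution function of the time of the `m`-th jump. -/
noncomputable def arrivalCdf {Ω : Type*} [MeasurableSpace Ω] (P : Measure Ω) (τ : ℕ → Ω → ℝ)
    (m : ℕ) (t : ℝ) : ℝ := P.real {ω | arrival τ m ω ≤ t}

/-- The event that exactly `m` jumps occur up to time `t`. -/
def jumpEvent {Ω : Type*} (τ : ℕ → Ω → ℝ) (m : ℕ) (t : ℝ) : Set Ω :=
  {ω | arrival τ m ω ≤ t} \ {ω | arrival τ (m + 1) ω ≤ t}

/-- Positive waits make the jump times strictly increasing, so the counted indices form an initial
segment. `hfin` excludes the infinite case, where `Set.ncard` would return 0. -/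
lemma exists_numJumps_eq {Ω : Type*} {τ : ℕ → Ω → ℝ} {t : ℝ} (ht : 0 ≤ t) {ω : Ω}
    (hpos : ∀ l, 0 < τ l ω) (hfin : ∃ m, t < arrival τ (m + 1) ω) (m : ℕ) :
    ω ∈ jumpEvent τ m t ↔ m = numJumps τ t ω := by
  have hmono : StrictMono fun m => arrival τ m ω := strictMono_nat_of_lt_succ fun m => by
    simp only [arrival, Finset.sum_range_succ]
    linarith [hpos m]
  classical
  have hset : {m : ℕ | ∑ l ∈ Finset.range (m + 1), τ l ω ≤ t} = Set.Iio (Nat.find hfin) := by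
    ext m
    simp only [Set.mem_ofPred_eq, Set.mem_Iio, Nat.lt_find_iff, not_lt]
    exact ⟨fun h k hk => (hmono.monotone (Nat.succ_le_succ hk)).trans h, fun h => h m le_rfl⟩
  rw [numJumps, hset, Set.ncard_Iio_nat, eq_comm, Nat.find_eq_iff]
  simp only [jumpEvent, Set.mem_sdiff, Set.mem_ofPred_eq, not_le, not_lt]
  constructor
  · rintro ⟨h1, h2⟩
    exact ⟨h2, fun k hk => (hmono.monotone hk).trans h1⟩
  · rintro ⟨h1, h2⟩
    refine ⟨?_, h1⟩
    rcases m with _ | m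
    · simpa [arrival] using ht
    · exact h2 m (Nat.lt_succ_self m)

lemma hasSum_indicator_jumpEvent {Ω : Type*} {τ ξ : ℕ → Ω → ℝ} {𝕜 : Type*} [RCLike 𝕜]
    {F : ℝ → 𝕜} {t : ℝ} {ω : Ω}
    (hω : ∀ m, ω ∈ jumpEvent τ m t ↔ m = numJumps τ t ω) :
    HasSum (fun m => (jumpEvent τ m t).indicator (fun _ => (1 : 𝕜)) ω *
      F (∑ l ∈ Finset.range m, ξ l ω)) (F (position τ ξ t ω)) := by
  have h1 := hasSum_single (f := fun m => (jumpEvent τ m t).indicator (fun _ => (1 : 𝕜)) ω *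
      F (∑ l ∈ Finset.range m, ξ l ω)) (numJumps τ t ω) (fun m hm => by
        rw [Set.indicator_of_notMem (mt (hω m).1 hm), zero_mul])
  simp only [Set.indicator_of_mem ((hω _).2 rfl), one_mul] at h1
  exact h1

variable {Ω S : Type*} [MeasurableSpace Ω] {P : Measure Ω}
  {init : S → ℝ} {M : Matrix S S ℝ} {wait : S → Measure ℝ} {γ : Measure ℝ}
  {Z : ℕ → Ω → S} {τ ξ : ℕ → Ω → ℝ}

lemma measurable_arrival {τ : ℕ → Ω → ℝ} (hτ : ∀ m, Measurable (τ m)) (m : ℕ) :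
    Measurable (arrival τ m) := by
  unfold arrival; fun_prop

lemma measurableSet_jumpEvent {τ : ℕ → Ω → ℝ} (hτ : ∀ m, Measurable (τ m)) (m : ℕ) (t : ℝ) :
    MeasurableSet (jumpEvent τ m t) :=
  (measurableSet_le (measurable_arrival hτ _) measurable_const).diff
    (measurableSet_le (measurable_arrival hτ _) measurable_const)

lemma arrivalCdf_nonneg (m : ℕ) (t : ℝ) : 0 ≤ arrivalCdf P τ m t := measureReal_nonneg

variable [Fintype S] [∀ a, IsProbabilityMeasure (wait a)] [IsProbabilityMeasure γ]

lemma arrival_nonneg_ae (h : IsInternalStateWalk P init M wait (fun _ => γ) Z τ ξ)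
    (hpos : ∀ a, ∀ᵐ x ∂wait a, 0 < x) (m : ℕ) : ∀ᵐ ω ∂P, 0 ≤ arrival τ m ω := by
  filter_upwards [wait_pos h hpos] with ω hω
  exact Finset.sum_nonneg fun l _ => (hω l).le

variable [IsProbabilityMeasure P]

lemma arrivalCdf_mono (m : ℕ) : Monotone (arrivalCdf P τ m) := fun _ _ hst =>
  measureReal_mono fun _ hω => le_trans hω hst

lemma measureReal_jumpEvent (h : IsInternalStateWalk P init M wait (fun _ => γ) Z τ ξ)
    (hpos : ∀ a, ∀ᵐ x ∂wait a, 0 < x) (m : ℕ) (t : ℝ) :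
    P.real (jumpEvent τ m t) = arrivalCdf P τ m t - arrivalCdf P τ (m + 1) t := by
  have h1 := measureReal_inter_add_sdiff (μ := P) (s := {ω | arrival τ m ω ≤ t})
    (measurableSet_le (measurable_arrival h.measurable_wait (m + 1)) (measurable_const (a := t)))
  have h2 : P.real ({ω | arrival τ m ω ≤ t} ∩ {ω | arrival τ (m + 1) ω ≤ t}) =
      arrivalCdf P τ (m + 1) t := by
    refine measureReal_congr ?_
    filter_upwards [wait_pos h hpos] with ω hω
    refine propext ⟨fun hx => hx.2, fun hx => ⟨?_, hx⟩⟩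
    have h3 : arrival τ (m + 1) ω ≤ t := hx
    simp only [arrival, Finset.sum_range_succ] at h3
    change ∑ l ∈ Finset.range m, τ l ω ≤ t
    linarith [hω m]
  rw [h2] at h1
  exact eq_sub_of_add_eq' h1

lemma arrivalCdf_succ_le (h : IsInternalStateWalk P init M wait (fun _ => γ) Z τ ξ)
    (hpos : ∀ a, ∀ᵐ x ∂wait a, 0 < x) (m : ℕ) (t : ℝ) :
    arrivalCdf P τ (m + 1) t ≤ arrivalCdf P τ m t := by
  have := measureReal_jumpEvent h hpos m t
  linarith [measureReal_nonneg (μ := P) (s := jumpEvent τ m t)]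

/-- The event depends only on the first `m + 1` waits, the other factor only on the jumps, so
independence factors the expectation. -/
lemma integral_indicator_jumpEvent_mul {𝕜 : Type*} [RCLike 𝕜]
    (h : IsInternalStateWalk P init M wait (fun _ => γ) Z τ ξ) (m : ℕ) (t : ℝ)
    {F : ℝ → 𝕜} (hF : Measurable F) :
    ∫ ω, (jumpEvent τ m t).indicator (fun _ => (1 : 𝕜)) ω * F (∑ l ∈ Finset.range m, ξ l ω) ∂P =
      (P.real (jumpEvent τ m t) : 𝕜) * ∫ ω, F (∑ l ∈ Finset.range m, ξ l ω) ∂P := by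
  have hτ := h.measurable_wait
  have hξ := h.measurable_jump
  set A : Set (Fin (m + 1) → ℝ) := {x | ∑ l : Fin m, x l.castSucc ≤ t} \ {x | ∑ l, x l ≤ t}
  have hA : MeasurableSet A := (measurableSet_le (by fun_prop) (by fun_prop)).diff
    (measurableSet_le (by fun_prop) (by fun_prop))
  have hφ : Measurable (A.indicator fun _ => (1 : 𝕜)) := measurable_const.indicator hA
  have hψ : Measurable fun x : Fin (m + 1) → ℝ => F (∑ l : Fin m, x l.castSucc) :=
    hF.comp (by fun_prop)
  have hind := (indepFun_wait_jump h m).comp hφ hψ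
  have e1 : (A.indicator fun _ => (1 : 𝕜)) ∘ (fun ω => fun l : Fin (m + 1) => τ l ω) =
      (jumpEvent τ m t).indicator (fun _ => (1 : 𝕜)) := by
    ext ω
    simp only [Function.comp, Set.indicator, A, jumpEvent, arrival, Finset.sum_range, Set.mem_sdiff,
      Set.mem_ofPred_eq, Fin.val_castSucc]
  have e2 : (fun x : Fin (m + 1) → ℝ => F (∑ l : Fin m, x l.castSucc)) ∘
      (fun ω => fun l : Fin (m + 1) => ξ l ω) = fun ω => F (∑ l ∈ Finset.range m, ξ l ω) := by
    ext ω
    simp [Function.comp, Finset.sum_range]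
  rw [e1, e2] at hind
  rw [hind.integral_fun_mul_eq_mul_integral
    (measurable_const.indicator (measurableSet_jumpEvent hτ m t)).aestronglyMeasurable
    (hF.comp (by fun_prop)).aestronglyMeasurable,
    integral_indicator_const _ (measurableSet_jumpEvent hτ m t), Algebra.smul_def, mul_one]

lemma integral_cexp_jumps (h : IsInternalStateWalk P init M wait (fun _ => γ) Z τ ξ) (m : ℕ)
    (k : ℝ) : ∫ ω, Complex.exp (k * (∑ l ∈ Finset.range m, ξ l ω : ℝ) * Complex.I) ∂P =
      charFun γ k ^ m := by
  have hξ := h.measurable_jump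
  rcases m with _ | m
  · simp
  · have h1 := integral_fintype_prod_eq_prod (𝕜 := ℂ) (ι := Fin (m + 1)) (μ := fun _ => γ)
      (fun _ (x : ℝ) => Complex.exp (k * x * Complex.I))
    rw [Finset.prod_const, Finset.card_univ, Fintype.card_fin, ← charFun_apply_real] at h1
    rw [← h1, ← map_jump h, integral_map (by fun_prop)
      (Measurable.aestronglyMeasurable (by fun_prop))]
    refine integral_congr_ae (Eventually.of_forall fun ω => ?_)
    simp only
    rw [← Complex.exp_sum, Finset.sum_range, Complex.ofReal_sum, Finset.mul_sum, Finset.sum_mul]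

variable [DecidableEq S]

lemma integral_waitLaw (hM : M ∈ Matrix.rowStochastic ℝ S) (hinit : ∀ a, 0 ≤ init a)
    {f : ℝ → ℝ} (hf : ∀ a, Integrable f (wait a)) (m : ℕ) :
    ∫ x, ∏ l, f (x l) ∂waitLaw init M wait m =
      ∑ a, init a * iter M (fun a => ∫ x, f x ∂wait a) (m + 1) a := by
  have hint : ∀ a : Fin (m + 1) → S,
      Integrable (fun x : Fin (m + 1) → ℝ => ∏ l, f (x l)) (Measure.pi fun l => wait (a l)) :=
    fun a => Integrable.fintype_prod fun l => hf (a l)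
  rw [waitLaw, integral_finsetSum_measure fun a _ => (hint a).smul_measure (pathWeight_ne_top m a),
    ← sum_paths hM]
  refine Finset.sum_congr rfl fun a _ => ?_
  rw [integral_smul_measure, integral_fintype_prod_eq_prod (fun _ => f), smul_eq_mul, pathWeight,
    ENNReal.toReal_mul, ENNReal.toReal_prod, ENNReal.toReal_ofReal (hinit _)]
  congr 2
  exact Finset.prod_congr rfl fun l _ =>
    ENNReal.toReal_ofReal (Matrix.nonneg_of_mem_rowStochastic hM)

lemma integral_exp_arrival (h : IsInternalStateWalk P init M wait (fun _ => γ) Z τ ξ)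
    (hM : M ∈ Matrix.rowStochastic ℝ S) (hinit : IsDistribution init)
    (hpos : ∀ a, ∀ᵐ x ∂wait a, 0 < x) {s : ℝ} (hs : 0 < s) (m : ℕ) :
    ∫ ω, Real.exp (-(s * arrival τ m ω)) ∂P =
      ∑ a, init a * iter M (fun a => waitLaplace (wait a) s) m a := by
  have hτ := h.measurable_wait
  rcases m with _ | m
  · simp [arrival, iter, hinit.2]
  · have hf : ∀ a, Integrable (fun x => Real.exp (-(s * x))) (wait a) := fun a =>
      integrable_exp_neg_mul measurable_id ((hpos a).mono fun x hx => le_of_lt hx) hs.le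
    have h1 := integral_waitLaw hM hinit.1 hf m
    rw [← map_wait h, integral_map (by fun_prop)
      (Measurable.aestronglyMeasurable (by fun_prop))] at h1
    refine Eq.trans ?_ h1
    refine integral_congr_ae (Eventually.of_forall fun ω => ?_)
    simp only
    rw [arrival, ← Real.exp_sum, Finset.sum_range, Finset.sum_neg_distrib, Finset.mul_sum]

/-- Chernoff bound with exponent -1: the transform of the m-th jump time at s = 1 is at most ρ^m. -/
lemma exists_arrivalCdf_le (h : IsInternalStateWalk P init M wait (fun _ => γ) Z τ ξ)
    (hM : M ∈ Matrix.rowStochastic ℝ S) (hinit : IsDistribution init)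
    (hpos : ∀ a, ∀ᵐ x ∂wait a, 0 < x) :
    ∃ ρ : ℝ, 0 ≤ ρ ∧ ρ < 1 ∧ ∀ m t, arrivalCdf P τ m t ≤ Real.exp t * ρ ^ m := by
  obtain ⟨ρ, hρ0, hρ1, hρ⟩ := exists_waitLaplace_le hpos one_pos
  refine ⟨ρ, hρ0, hρ1, fun m t => ?_⟩
  have hint : Integrable (fun ω => Real.exp (-1 * arrival τ m ω)) P := by
    simpa using integrable_exp_neg_mul (measurable_arrival h.measurable_wait m)
      (arrival_nonneg_ae h hpos m) zero_le_one
  have h1 := measure_le_le_exp_mul_mgf (μ := P) (X := arrival τ m) t (t := -1) (by norm_num) hint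
  have h2 : mgf (arrival τ m) P (-1) ≤ ρ ^ m := by
    have h3 := integral_exp_arrival h hM hinit hpos one_pos m
    have h4 : mgf (arrival τ m) P (-1) = ∫ ω, Real.exp (-(1 * arrival τ m ω)) ∂P := by
      simp [mgf]
    rw [h4, h3]
    calc _ ≤ ∑ a, init a * ρ ^ m := Finset.sum_le_sum fun a _ =>
          mul_le_mul_of_nonneg_left
            (iter_le_pow hM (fun a => waitLaplace_nonneg _ _) hρ m a) (hinit.1 a)
      _ = ρ ^ m := by rw [← Finset.sum_mul, hinit.2, one_mul]
  refine h1.trans ?_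
  rw [neg_neg, one_mul]
  exact mul_le_mul_of_nonneg_left h2 (Real.exp_pos t).le

/-- Borel–Cantelli: the probabilities of at least `m` jumps are summable, so almost surely only
finitely many jumps occur by time `t`. -/
lemma mem_jumpEvent_iff_ae (h : IsInternalStateWalk P init M wait (fun _ => γ) Z τ ξ)
    (hM : M ∈ Matrix.rowStochastic ℝ S) (hinit : IsDistribution init)
    (hpos : ∀ a, ∀ᵐ x ∂wait a, 0 < x) {t : ℝ} (ht : 0 ≤ t) :
    ∀ᵐ ω ∂P, ∀ m, ω ∈ jumpEvent τ m t ↔ m = numJumps τ t ω := by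
  obtain ⟨ρ, hρ0, hρ1, hρ⟩ := exists_arrivalCdf_le h hM hinit hpos
  have hsum : Summable fun m => arrivalCdf P τ m t :=
    Summable.of_nonneg_of_le (fun m => arrivalCdf_nonneg m t) (fun m => hρ m t)
      ((summable_geometric_of_lt_one hρ0 hρ1).mul_left _)
  have htop : ∑' m, P {ω | arrival τ m ω ≤ t} ≠ ⊤ := by
    have : ∀ m, P {ω | arrival τ m ω ≤ t} = ENNReal.ofReal (arrivalCdf P τ m t) := fun m =>
      (ofReal_measureReal (measure_ne_top _ _)).symm
    simp_rw [this]
    exact hsum.tsum_ofReal_ne_top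
  filter_upwards [wait_pos h hpos, ae_eventually_notMem htop] with ω h1 h2
  obtain ⟨m, hm⟩ := ((tendsto_add_atTop_nat 1).eventually h2).exists
  exact exists_numJumps_eq ht h1 ⟨m, not_le.1 hm⟩

/-- The position is an almost sure limit of measurable partial sums, so `numJumps` itself need not
be shown measurable. Without this, `P.map` would be the zero measure by default. -/
lemma aemeasurable_position (h : IsInternalStateWalk P init M wait (fun _ => γ) Z τ ξ)
    (hM : M ∈ Matrix.rowStochastic ℝ S) (hinit : IsDistribution init)
    (hpos : ∀ a, ∀ᵐ x ∂wait a, 0 < x) {t : ℝ} (ht : 0 ≤ t) :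
    AEMeasurable (position τ ξ t) P := by
  have hξ := h.measurable_jump
  refine aemeasurable_of_tendsto_metrizable_ae'
    (f := fun N ω => ∑ m ∈ Finset.range N, (jumpEvent τ m t).indicator (fun _ => (1 : ℝ)) ω *
      ∑ l ∈ Finset.range m, ξ l ω) (fun N => ?_) ?_
  · refine (Finset.measurable_fun_sum _ fun m _ => ?_).aemeasurable
    exact (measurable_const.indicator (measurableSet_jumpEvent h.measurable_wait m t)).mul
      (by fun_prop)
  · filter_upwards [mem_jumpEvent_iff_ae h hM hinit hpos ht] with ω hω
    exact (hasSum_indicator_jumpEvent (F := fun x : ℝ => x) hω).tendsto_sum_nat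

lemma hasSum_integral_position {𝕜 : Type*} [RCLike 𝕜]
    (h : IsInternalStateWalk P init M wait (fun _ => γ) Z τ ξ)
    (hM : M ∈ Matrix.rowStochastic ℝ S) (hinit : IsDistribution init)
    (hpos : ∀ a, ∀ᵐ x ∂wait a, 0 < x) {t : ℝ} (ht : 0 ≤ t) {F : ℝ → 𝕜} (hF : Measurable F)
    (hint : ∀ m, Integrable (fun ω => F (∑ l ∈ Finset.range m, ξ l ω)) P)
    (hsum : Summable fun m => P.real (jumpEvent τ m t) *
      ∫ ω, ‖F (∑ l ∈ Finset.range m, ξ l ω)‖ ∂P) :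
    HasSum (fun m => (P.real (jumpEvent τ m t) : 𝕜) * ∫ ω, F (∑ l ∈ Finset.range m, ξ l ω) ∂P)
      (∫ ω, F (position τ ξ t ω) ∂P) := by
  have hnorm : ∀ m ω, ‖(jumpEvent τ m t).indicator (fun _ => (1 : 𝕜)) ω *
      F (∑ l ∈ Finset.range m, ξ l ω)‖ = (jumpEvent τ m t).indicator (fun _ => (1 : ℝ)) ω *
      ‖F (∑ l ∈ Finset.range m, ξ l ω)‖ := by
    intro m ω
    rw [norm_mul, norm_indicator_eq_indicator_norm, norm_one]
  have h1 := hasSum_integral_of_summable_integral_norm (E := 𝕜) (μ := P)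
    (F := fun m ω => (jumpEvent τ m t).indicator (fun _ => (1 : 𝕜)) ω *
      F (∑ l ∈ Finset.range m, ξ l ω)) (fun m => ?_) ?_
  · have h2 : ∫ ω, F (position τ ξ t ω) ∂P = ∫ ω, ∑' m,
        (jumpEvent τ m t).indicator (fun _ => (1 : 𝕜)) ω *
          F (∑ l ∈ Finset.range m, ξ l ω) ∂P := by
      refine integral_congr_ae ?_
      filter_upwards [mem_jumpEvent_iff_ae h hM hinit hpos ht] with ω hω
      exact (hasSum_indicator_jumpEvent hω).tsum_eq.symm
    rw [h2]
    simpa only [integral_indicator_jumpEvent_mul h _ t hF] using h1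
  · refine (hint m).bdd_mul (c := 1) ?_ ?_
    · exact (measurable_const.indicator
        (measurableSet_jumpEvent h.measurable_wait m t)).aestronglyMeasurable
    · refine Eventually.of_forall fun ω => ?_
      rw [norm_indicator_eq_indicator_norm, norm_one]
      exact Set.indicator_le_self' (fun _ _ => zero_le_one) ω
  · simp_rw [hnorm]
    exact hsum.congr fun m => (integral_indicator_jumpEvent_mul (𝕜 := ℝ) h m t hF.norm).symm

end Arrivals

/-! ### Resolvent series and their fixed-point equations. -/

section Series

/-- Abel summation, the identity E N = ∑ P(N ≥ m) in disguise; the geometric bound makes `m * G m`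
summable, which justifies the rearrangement. -/
lemma tsum_mul_sub_succ {G : ℕ → ℝ} {C ρ : ℝ} (hρ0 : 0 ≤ ρ) (hρ1 : ρ < 1) (hG0 : ∀ m, 0 ≤ G m)
    (hG : ∀ m, G m ≤ C * ρ ^ m) :
    Summable (fun m : ℕ => (m : ℝ) * (G m - G (m + 1))) ∧
      ∑' m : ℕ, (m : ℝ) * (G m - G (m + 1)) = ∑' m, G (m + 1) := by
  have hs : Summable G := Summable.of_nonneg_of_le hG0 hG
    ((summable_geometric_of_lt_one hρ0 hρ1).mul_left C)
  have hms : Summable fun m : ℕ => (m : ℝ) * G m := by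
    have h1 := (summable_pow_mul_geometric_of_norm_lt_one 1
      (show ‖ρ‖ < 1 by rwa [Real.norm_of_nonneg hρ0])).mul_left C
    refine Summable.of_nonneg_of_le (fun m => mul_nonneg (Nat.cast_nonneg m) (hG0 m))
      (fun m => ?_) h1
    calc (m : ℝ) * G m ≤ m * (C * ρ ^ m) := mul_le_mul_of_nonneg_left (hG m) (Nat.cast_nonneg m)
      _ = C * ((m : ℝ) ^ 1 * ρ ^ m) := by ring
  have hs1 : Summable fun m => G (m + 1) := (summable_nat_add_iff 1).2 hs
  have hms1 : Summable fun m : ℕ => ((m + 1 : ℕ) : ℝ) * G (m + 1) :=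
    (summable_nat_add_iff (f := fun m : ℕ => (m : ℝ) * G m) 1).2 hms
  have h0 := hms.tsum_eq_zero_add
  simp only [Nat.cast_zero, zero_mul, zero_add] at h0
  have hterm : ∀ m : ℕ, (m : ℝ) * (G m - G (m + 1)) =
      (m * G m - ((m + 1 : ℕ) : ℝ) * G (m + 1)) + G (m + 1) := fun m => by push_cast; ring
  simp_rw [hterm]
  refine ⟨(hms.sub hms1).add hs1, ?_⟩
  rw [(hms.sub hms1).tsum_add hs1, hms.tsum_sub hms1, h0, sub_self, zero_add]

/-- Peel off the zeroth term and apply the recursion to the rest; both resolvent equations come from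
here. -/
lemma tsum_eq_add_mulVec {S : Type*} [Fintype S] {M : Matrix S S ℝ} {d : S → ℝ} {y : ℕ → S → ℝ}
    (hy : ∀ a, Summable fun m => y m a) (hstep : ∀ m a, y (m + 1) a = d a * (M.mulVec (y m)) a)
    (a : S) :
    ∑' m, y m a = y 0 a + d a * (M.mulVec fun b => ∑' m, y m b) a := by
  rw [(hy a).tsum_eq_zero_add]
  congr 1
  simp_rw [hstep, tsum_mul_left]
  congr 1
  simp only [Matrix.mulVec, dotProduct]
  rw [Summable.tsum_finsetSum fun b _ => (hy b).mul_left _]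
  simp_rw [tsum_mul_left]

variable {S : Type*} [Fintype S] [DecidableEq S] {M : Matrix S S ℝ}

/-- Laplace-Fourier transform of the walk started in a given state, times `s`: the sum of
`q ^ m (Φ M) ^ m (1 - Φ M) 1`. -/
noncomputable def resolventSurvival (M : Matrix S S ℝ) (φ : S → ℝ) (q : ℝ) (a : S) : ℝ :=
  ∑' m, q ^ m * (iter M φ m a - iter M φ (m + 1) a)

/-- Laplace transform of the mean number of jumps of the walk started in a given state, times
`s`: the sum of `(Φ M) ^ (m + 1) 1`. -/
noncomputable def resolventRenewal (M : Matrix S S ℝ) (φ : S → ℝ) (a : S) : ℝ :=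
  ∑' m, iter M φ (m + 1) a

variable {φ : S → ℝ} {ρ : ℝ}

lemma summable_iter (hM : M ∈ Matrix.rowStochastic ℝ S) (hφ : ∀ a, 0 ≤ φ a) (hρ0 : 0 ≤ ρ)
    (hρ1 : ρ < 1) (hρ : ∀ a, φ a ≤ ρ) (a : S) : Summable fun m => iter M φ m a :=
  Summable.of_nonneg_of_le (fun m => iter_nonneg hM hφ m a) (fun m => iter_le_pow hM hφ hρ m a)
    (summable_geometric_of_lt_one hρ0 hρ1)

lemma summable_survival (hM : M ∈ Matrix.rowStochastic ℝ S) (hφ : ∀ a, 0 ≤ φ a) (hρ0 : 0 ≤ ρ)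
    (hρ1 : ρ < 1) (hρ : ∀ a, φ a ≤ ρ) {q : ℝ} (hq0 : 0 ≤ q) (hq1 : q ≤ 1) (a : S) :
    Summable fun m => q ^ m * (iter M φ m a - iter M φ (m + 1) a) := by
  refine Summable.of_nonneg_of_le (fun m => mul_nonneg (pow_nonneg hq0 m)
    (sub_nonneg.2 (iter_succ_le hM hφ (fun a => (hρ a).trans hρ1.le) m a))) (fun m => ?_)
    (summable_iter hM hφ hρ0 hρ1 hρ a)
  refine (mul_le_of_le_one_left (sub_nonneg.2
    (iter_succ_le hM hφ (fun a => (hρ a).trans hρ1.le) m a)) (pow_le_one₀ hq0 hq1)).trans ?_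
  linarith [iter_nonneg hM hφ (m + 1) a]

lemma resolventSurvival_nonneg (hM : M ∈ Matrix.rowStochastic ℝ S) (hφ : ∀ a, 0 ≤ φ a)
    (hφ1 : ∀ a, φ a ≤ 1) {q : ℝ} (hq0 : 0 ≤ q) (a : S) : 0 ≤ resolventSurvival M φ q a :=
  tsum_nonneg fun m => mul_nonneg (pow_nonneg hq0 m) (sub_nonneg.2 (iter_succ_le hM hφ hφ1 m a))

lemma resolventRenewal_nonneg (hM : M ∈ Matrix.rowStochastic ℝ S) (hφ : ∀ a, 0 ≤ φ a) (a : S) :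
    0 ≤ resolventRenewal M φ a :=
  tsum_nonneg fun m => iter_nonneg hM hφ (m + 1) a

lemma resolventSurvival_eq (hM : M ∈ Matrix.rowStochastic ℝ S) (hφ : ∀ a, 0 ≤ φ a) (hρ0 : 0 ≤ ρ)
    (hρ1 : ρ < 1) (hρ : ∀ a, φ a ≤ ρ) {q : ℝ} (hq0 : 0 ≤ q) (hq1 : q ≤ 1) (a : S) :
    resolventSurvival M φ q a =
      (1 - φ a) + (q * φ a) * (M.mulVec (resolventSurvival M φ q)) a := by
  have h := tsum_eq_add_mulVec (M := M) (d := fun a => q * φ a)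
    (y := fun m a => q ^ m * (iter M φ m a - iter M φ (m + 1) a))
    (summable_survival hM hφ hρ0 hρ1 hρ hq0 hq1) (fun m a => ?_) a
  · simp only [pow_zero, one_mul, zero_add, iter_one hM] at h
    exact h
  · have h1 : (fun a => q ^ m * (iter M φ m a - iter M φ (m + 1) a)) =
        q ^ m • (iter M φ m - iter M φ (m + 1)) := rfl
    rw [h1, Matrix.mulVec_smul, Matrix.mulVec_sub]
    simp only [iter, Pi.smul_apply, Pi.sub_apply, smul_eq_mul]
    ring

lemma resolventRenewal_eq (hM : M ∈ Matrix.rowStochastic ℝ S) (hφ : ∀ a, 0 ≤ φ a) (hρ0 : 0 ≤ ρ)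
    (hρ1 : ρ < 1) (hρ : ∀ a, φ a ≤ ρ) (a : S) :
    resolventRenewal M φ a = φ a + φ a * (M.mulVec (resolventRenewal M φ)) a := by
  have h := tsum_eq_add_mulVec (M := M) (d := φ) (y := fun m a => iter M φ (m + 1) a)
    (fun a => (summable_nat_add_iff (f := fun m => iter M φ m a) 1).2
      (summable_iter hM hφ hρ0 hρ1 hρ a)) (fun m a => rfl) a
  simp only [zero_add, iter_one hM] at h
  exact h

end Series

/-! ### Gaussian jumps: characteristic function and mean square. -/

section Gaussian

variable {Ω S : Type*} [MeasurableSpace Ω] {P : Measure Ω} [Fintype S]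
  {init : S → ℝ} {M : Matrix S S ℝ} {wait : S → Measure ℝ} {v : NNReal}
  {Z : ℕ → Ω → S} {τ ξ : ℕ → Ω → ℝ} [IsProbabilityMeasure P]
  [∀ a, IsProbabilityMeasure (wait a)]

lemma charFun_centered_gaussian (v : NNReal) (k : ℝ) :
    charFun (gaussianReal 0 v) k = (Real.exp (-(v * k ^ 2 / 2)) : ℂ) := by
  rw [charFun_gaussianReal]
  push_cast
  congr 1
  ring

lemma map_jumps (h : IsInternalStateWalk P init M wait (fun _ => gaussianReal 0 v) Z τ ξ) (m : ℕ) :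
    P.map (fun ω => ∑ l ∈ Finset.range m, ξ l ω) = gaussianReal 0 (m * v) := by
  have hξ := h.measurable_jump
  have hmeas : AEMeasurable (fun ω => ∑ l ∈ Finset.range m, ξ l ω) P := by fun_prop
  have := Measure.isProbabilityMeasure_map hmeas
  refine Measure.ext_of_charFun ?_
  ext k
  rw [charFun_apply_real, integral_map hmeas (Measurable.aestronglyMeasurable (by fun_prop)),
    integral_cexp_jumps h, charFun_centered_gaussian, charFun_centered_gaussian,
    ← Complex.ofReal_pow, ← Real.exp_nat_mul]
  congr 2
  push_cast
  ring

lemma integrable_sq_jumps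
    (h : IsInternalStateWalk P init M wait (fun _ => gaussianReal 0 v) Z τ ξ) (m : ℕ) :
    Integrable (fun ω => (∑ l ∈ Finset.range m, ξ l ω) ^ 2) P := by
  have hξ := h.measurable_jump
  have h1 : Integrable (fun x : ℝ => x ^ 2) (gaussianReal 0 (m * v)) :=
    (memLp_id_gaussianReal' 2 (by simp)).integrable_sq
  rw [← map_jumps h] at h1
  exact h1.comp_measurable (by fun_prop)

lemma integral_sq_jumps
    (h : IsInternalStateWalk P init M wait (fun _ => gaussianReal 0 v) Z τ ξ) (m : ℕ) :
    ∫ ω, (∑ l ∈ Finset.range m, ξ l ω) ^ 2 ∂P = m * v := by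
  have hξ := h.measurable_jump
  have h1 := variance_fun_id_gaussianReal (μ := 0) (v := m * v)
  rw [variance_eq_integral measurable_id'.aemeasurable, integral_id_gaussianReal] at h1
  simp only [sub_zero] at h1
  rw [← map_jumps h, integral_map (by fun_prop)
    (Measurable.aestronglyMeasurable (by fun_prop))] at h1
  simpa using h1

variable [DecidableEq S]

lemma charFun_position (h : IsInternalStateWalk P init M wait (fun _ => gaussianReal 0 v) Z τ ξ)
    (hM : M ∈ Matrix.rowStochastic ℝ S) (hinit : IsDistribution init)
    (hpos : ∀ a, ∀ᵐ x ∂wait a, 0 < x) {t : ℝ} (ht : 0 ≤ t) (k : ℝ) :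
    charFun (P.map (position τ ξ t)) k =
      ((∑' m, Real.exp (-(v * k ^ 2 / 2)) ^ m *
        (arrivalCdf P τ m t - arrivalCdf P τ (m + 1) t) : ℝ) : ℂ) := by
  have hξ := h.measurable_jump
  obtain ⟨ρ, hρ0, hρ1, hρ⟩ := exists_arrivalCdf_le h hM hinit hpos
  rw [charFun_apply_real, integral_map (aemeasurable_position h hM hinit hpos ht)
    (Measurable.aestronglyMeasurable (by fun_prop))]
  have hnorm : ∀ x : ℝ, ‖Complex.exp (k * x * Complex.I)‖ = 1 := fun x => by
    rw [← Complex.ofReal_mul, Complex.norm_exp_ofReal_mul_I]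
  have h1 := hasSum_integral_position (𝕜 := ℂ) h hM hinit hpos ht
    (F := fun x => Complex.exp (k * x * Complex.I)) (by fun_prop) (fun m => ?_) ?_
  · rw [← h1.tsum_eq, Complex.ofReal_tsum]
    refine tsum_congr fun m => ?_
    rw [integral_cexp_jumps h, charFun_centered_gaussian, measureReal_jumpEvent h hpos]
    change ((arrivalCdf P τ m t - arrivalCdf P τ (m + 1) t : ℝ) : ℂ) * _ = _
    push_cast
    ring
  · exact Integrable.of_bound (Measurable.aestronglyMeasurable (by fun_prop)) 1
      (Eventually.of_forall fun ω => (hnorm _).le)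
  · simp_rw [hnorm]
    simp only [integral_const, probReal_univ, smul_eq_mul, mul_one, measureReal_jumpEvent h hpos]
    refine Summable.of_nonneg_of_le (fun m => sub_nonneg.2 (arrivalCdf_succ_le h hpos m t))
      (fun m => ?_) ((summable_geometric_of_lt_one hρ0 hρ1).mul_left (Real.exp t))
    linarith [arrivalCdf_nonneg (P := P) (τ := τ) (m + 1) t, hρ m t]

lemma msd_position (h : IsInternalStateWalk P init M wait (fun _ => gaussianReal 0 v) Z τ ξ)
    (hM : M ∈ Matrix.rowStochastic ℝ S) (hinit : IsDistribution init)
    (hpos : ∀ a, ∀ᵐ x ∂wait a, 0 < x) {t : ℝ} (ht : 0 ≤ t) :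
    msd P (position τ ξ) t = v * ∑' m, arrivalCdf P τ (m + 1) t := by
  obtain ⟨ρ, hρ0, hρ1, hρ⟩ := exists_arrivalCdf_le h hM hinit hpos
  obtain ⟨hs, hsum⟩ := tsum_mul_sub_succ hρ0 hρ1
    (fun m => arrivalCdf_nonneg (P := P) (τ := τ) m t) fun m => hρ m t
  have hterm : ∀ m : ℕ, P.real (jumpEvent τ m t) * ((m : ℝ) * v) =
      v * ((m : ℝ) * (arrivalCdf P τ m t - arrivalCdf P τ (m + 1) t)) := fun m => by
    rw [measureReal_jumpEvent h hpos]; ring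
  have h1 := hasSum_integral_position (𝕜 := ℝ) h hM hinit hpos ht
    (F := fun x => x ^ 2) (by fun_prop) (integrable_sq_jumps h) ?_
  · rw [msd, ← h1.tsum_eq, ← hsum, ← tsum_mul_left]
    refine tsum_congr fun m => ?_
    rw [integral_sq_jumps h, ← hterm]
    rfl
  · simp only [norm_pow, Real.norm_eq_abs, sq_abs, integral_sq_jumps h]
    simp_rw [hterm]
    exact hs.mul_left _

lemma summable_arrivalCdf
    (h : IsInternalStateWalk P init M wait (fun _ => gaussianReal 0 v) Z τ ξ)
    (hM : M ∈ Matrix.rowStochastic ℝ S) (hinit : IsDistribution init)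
    (hpos : ∀ a, ∀ᵐ x ∂wait a, 0 < x) (t : ℝ) : Summable fun m => arrivalCdf P τ m t := by
  obtain ⟨ρ, hρ0, hρ1, hρ⟩ := exists_arrivalCdf_le h hM hinit hpos
  exact Summable.of_nonneg_of_le (fun m => arrivalCdf_nonneg m t) (fun m => hρ m t)
    ((summable_geometric_of_lt_one hρ0 hρ1).mul_left _)

/-- The displacement is a multiple of the mean number of jumps, a sum of distribution functions.
This is the monotonicity that the Tauberian theorem needs. -/
lemma msd_monotoneOn (h : IsInternalStateWalk P init M wait (fun _ => gaussianReal 0 v) Z τ ξ)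
    (hM : M ∈ Matrix.rowStochastic ℝ S) (hinit : IsDistribution init)
    (hpos : ∀ a, ∀ᵐ x ∂wait a, 0 < x) : MonotoneOn (msd P (position τ ξ)) (Set.Ioi 0) := by
  intro x hx y hy hxy
  rw [msd_position h hM hinit hpos (le_of_lt hx), msd_position h hM hinit hpos (le_of_lt hy)]
  refine mul_le_mul_of_nonneg_left ?_ v.2
  have hs := fun t => (summable_nat_add_iff 1).2 (summable_arrivalCdf h hM hinit hpos t)
  exact (hs x).tsum_le_tsum (fun m => arrivalCdf_mono (m + 1) hxy) (hs y)

end Gaussian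

/-! ### Laplace transforms in time of the walk. -/

section Transforms

lemma hasSum_laplace {g : ℕ → ℝ → ℝ} {s : ℝ} (hg0 : ∀ m t, 0 < t → 0 ≤ g m t)
    (hint : ∀ m, IntegrableOn (fun t => Real.exp (-(s * t)) * g m t) (Set.Ioi 0))
    (hsum : Summable fun m => laplace (g m) s) :
    HasSum (fun m => laplace (g m) s) (laplace (fun t => ∑' m, g m t) s) := by
  have h1 := hasSum_integral_of_summable_integral_norm (μ := volume.restrict (Set.Ioi 0))
    (F := fun m t => Real.exp (-(s * t)) * g m t) hint ?_
  · simp only [tsum_mul_left] at h1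
    exact h1
  · refine hsum.congr fun m => ?_
    refine setIntegral_congr_fun measurableSet_Ioi fun t ht => ?_
    exact (Real.norm_of_nonneg (mul_nonneg (Real.exp_pos _).le (hg0 m t ht))).symm

lemma integral_exp_mul_indicator {s T : ℝ} (hs : 0 < s) (hT : 0 ≤ T) :
    ∫ t in Set.Ioi (0 : ℝ), Real.exp (-(s * t)) * (Set.Ici T).indicator (fun _ => (1 : ℝ)) t =
      Real.exp (-(s * T)) / s := by
  have h1 : ∀ t, Real.exp (-(s * t)) * (Set.Ici T).indicator (fun _ => (1 : ℝ)) t =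
      (Set.Ici T).indicator (fun t => Real.exp (-s * t)) t := fun t => by
    by_cases ht : t ∈ Set.Ici T
    · simp [ht]
    · simp [ht]
  simp_rw [h1]
  rw [setIntegral_congr_set (Ioi_ae_eq_Ici (a := (0 : ℝ))), setIntegral_indicator measurableSet_Ici,
    Set.inter_eq_right.2 (Set.Ici_subset_Ici.2 hT), integral_Ici_eq_integral_Ioi,
    integral_exp_mul_Ioi (neg_lt_zero.2 hs)]
  rw [neg_div_neg_eq, neg_mul]

variable {Ω S : Type*} [MeasurableSpace Ω] {P : Measure Ω} [Fintype S]
  {init : S → ℝ} {M : Matrix S S ℝ} {wait : S → Measure ℝ} {v : NNReal}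
  {Z : ℕ → Ω → S} {τ ξ : ℕ → Ω → ℝ}

lemma integral_indicator_arrival {X : Ω → ℝ} (hX : Measurable X) (c t : ℝ) :
    ∫ ω, c * (Set.Ici (X ω)).indicator (fun _ => (1 : ℝ)) t ∂P = c * P.real {ω | X ω ≤ t} := by
  rw [integral_const_mul]
  congr 1
  have h1 : (fun ω => (Set.Ici (X ω)).indicator (fun _ => (1 : ℝ)) t) =
      {ω | X ω ≤ t}.indicator fun _ => (1 : ℝ) := by
    ext ω; simp [Set.indicator]
  rw [h1, integral_indicator_const _ (measurableSet_le hX measurable_const), smul_eq_mul, mul_one]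

variable [IsProbabilityMeasure P]

lemma integrable_exp_mul_indicator {X : Ω → ℝ} (hX : Measurable X) {s : ℝ} (hs : 0 < s) :
    Integrable (Function.uncurry fun t ω =>
      Real.exp (-(s * t)) * (Set.Ici (X ω)).indicator (fun _ => (1 : ℝ)) t)
      ((volume.restrict (Set.Ioi 0)).prod P) := by
  have h0 : IntegrableOn (fun t : ℝ => Real.exp (-(s * t))) (Set.Ioi 0) := by
    simpa only [neg_mul] using exp_neg_integrableOn_Ioi 0 hs
  have h1 : Integrable (fun p : ℝ × Ω => Real.exp (-(s * p.1)))
      ((volume.restrict (Set.Ioi 0)).prod P) := Integrable.comp_fst h0 P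
  have hset : MeasurableSet {p : ℝ × Ω | X p.2 ≤ p.1} :=
    measurableSet_le (hX.comp measurable_snd) measurable_fst
  refine (h1.indicator hset).congr (Eventually.of_forall fun p => ?_)
  by_cases hp : X p.2 ≤ p.1
  · simp [Function.uncurry, Set.indicator, hp]
  · simp [Function.uncurry, Set.indicator, hp]

lemma integrableOn_exp_mul_arrivalCdf (hτ : ∀ m, Measurable (τ m)) {s : ℝ} (hs : 0 < s) (m : ℕ) :
    IntegrableOn (fun t => Real.exp (-(s * t)) * arrivalCdf P τ m t) (Set.Ioi 0) := by
  have h1 := (integrable_exp_mul_indicator (P := P) (measurable_arrival hτ m) hs).integral_prod_left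
  simp only [Function.uncurry, integral_indicator_arrival (measurable_arrival hτ m)] at h1
  exact h1

variable [∀ a, IsProbabilityMeasure (wait a)] [DecidableEq S]

/-- By Fubini, integrating exp(-st) over t ≥ T for a random jump time T gives E exp(-sT) / s. -/
lemma laplace_arrivalCdf (h : IsInternalStateWalk P init M wait (fun _ => gaussianReal 0 v) Z τ ξ)
    (hM : M ∈ Matrix.rowStochastic ℝ S) (hinit : IsDistribution init)
    (hpos : ∀ a, ∀ᵐ x ∂wait a, 0 < x) {s : ℝ} (hs : 0 < s) (m : ℕ) :
    laplace (arrivalCdf P τ m) s =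
      (∑ a, init a * iter M (fun a => waitLaplace (wait a) s) m a) / s := by
  have hτ := h.measurable_wait
  have h1 := integral_integral_swap
    (integrable_exp_mul_indicator (P := P) (measurable_arrival hτ m) hs)
  simp only [integral_indicator_arrival (measurable_arrival hτ m)] at h1
  rw [← integral_exp_arrival h hM hinit hpos hs, ← integral_div]
  refine h1.trans (integral_congr_ae ?_)
  filter_upwards [arrival_nonneg_ae h hpos m] with ω hω
  exact integral_exp_mul_indicator hs hω

lemma fourierLaplace_position
    (h : IsInternalStateWalk P init M wait (fun _ => gaussianReal 0 v) Z τ ξ)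
    (hM : M ∈ Matrix.rowStochastic ℝ S) (hinit : IsDistribution init)
    (hpos : ∀ a, ∀ᵐ x ∂wait a, 0 < x) {s : ℝ} (hs : 0 < s) (k : ℝ) :
    fourierLaplace P (position τ ξ) k s =
      ((∑ a, init a * resolventSurvival M (fun a => waitLaplace (wait a) s)
        (Real.exp (-(v * k ^ 2 / 2))) a) / s : ℝ) := by
  have hτ := h.measurable_wait
  obtain ⟨ρ, hρ0, hρ1, hρ⟩ := exists_waitLaplace_le hpos hs
  set φ := fun a => waitLaplace (wait a) s with hφdef
  have hφ : ∀ a, 0 ≤ φ a := fun a => waitLaplace_nonneg _ _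
  set q := Real.exp (-(v * k ^ 2 / 2)) with hq
  have hq0 : 0 ≤ q := (Real.exp_pos _).le
  have hq1 : q ≤ 1 := Real.exp_le_one_iff.2 (by
    have := v.2
    have : 0 ≤ (v : ℝ) * k ^ 2 / 2 := by positivity
    linarith)
  set g : ℕ → ℝ → ℝ := fun m t => q ^ m * (arrivalCdf P τ m t - arrivalCdf P τ (m + 1) t) with hg
  have hint : ∀ m, IntegrableOn (fun t => Real.exp (-(s * t)) * g m t) (Set.Ioi 0) := fun m => by
    have := ((integrableOn_exp_mul_arrivalCdf (P := P) hτ hs m).sub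
      (integrableOn_exp_mul_arrivalCdf (P := P) hτ hs (m + 1))).const_mul (q ^ m)
    refine IntegrableOn.congr_fun this (fun t _ => ?_) measurableSet_Ioi
    simp only [hg, Pi.sub_apply]
    ring
  have hlap : ∀ m, laplace (g m) s =
      ∑ a, init a / s * (q ^ m * (iter M φ m a - iter M φ (m + 1) a)) := by
    intro m
    have h1 : laplace (g m) s =
        q ^ m * (laplace (arrivalCdf P τ m) s - laplace (arrivalCdf P τ (m + 1)) s) := by
      simp only [laplace]
      rw [← integral_sub (integrableOn_exp_mul_arrivalCdf hτ hs m)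
        (integrableOn_exp_mul_arrivalCdf hτ hs (m + 1)), ← integral_const_mul]
      refine integral_congr_ae (Eventually.of_forall fun t => ?_)
      simp only [hg]
      ring
    rw [h1, laplace_arrivalCdf h hM hinit hpos hs, laplace_arrivalCdf h hM hinit hpos hs, ← sub_div,
      ← Finset.sum_sub_distrib, Finset.sum_div, Finset.mul_sum]
    exact Finset.sum_congr rfl fun a _ => by ring
  have hsurv := fun a => summable_survival hM hφ hρ0 hρ1 hρ hq0 hq1 a
  have hsum : Summable fun m => laplace (g m) s := by
    simp_rw [hlap]
    exact summable_sum fun a _ => (hsurv a).mul_left _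
  have h2 : HasSum (fun m => laplace (g m) s) (laplace (fun t => ∑' m, g m t) s) :=
    hasSum_laplace (fun m t _ => mul_nonneg (pow_nonneg hq0 m)
    (sub_nonneg.2 (arrivalCdf_succ_le h hpos m t))) hint hsum
  have h3 : laplace (fun t => ∑' m, g m t) s =
      (∑ a, init a * resolventSurvival M φ q a) / s := by
    rw [← h2.tsum_eq]
    simp_rw [hlap]
    rw [Summable.tsum_finsetSum fun a _ => (hsurv a).mul_left _, Finset.sum_div]
    refine Finset.sum_congr rfl fun a _ => ?_
    rw [tsum_mul_left, resolventSurvival]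
    ring
  rw [← h3, laplace, fourierLaplace, ← integral_complex_ofReal]
  refine setIntegral_congr_fun measurableSet_Ioi fun t ht => ?_
  rw [charFun_position h hM hinit hpos (le_of_lt ht), ← Complex.ofReal_mul]

lemma laplace_msd_position
    (h : IsInternalStateWalk P init M wait (fun _ => gaussianReal 0 v) Z τ ξ)
    (hM : M ∈ Matrix.rowStochastic ℝ S) (hinit : IsDistribution init)
    (hpos : ∀ a, ∀ᵐ x ∂wait a, 0 < x) {s : ℝ} (hs : 0 < s) :
    laplace (msd P (position τ ξ)) s =
      v * (∑ a, init a * resolventRenewal M (fun a => waitLaplace (wait a) s) a) / s := by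
  have hτ := h.measurable_wait
  obtain ⟨ρ, hρ0, hρ1, hρ⟩ := exists_waitLaplace_le hpos hs
  set φ := fun a => waitLaplace (wait a) s with hφdef
  have hφ : ∀ a, 0 ≤ φ a := fun a => waitLaplace_nonneg _ _
  have hren : ∀ a, Summable fun m => iter M φ (m + 1) a := fun a =>
    (summable_nat_add_iff (f := fun m => iter M φ m a) 1).2 (summable_iter hM hφ hρ0 hρ1 hρ a)
  have hlap : ∀ m, laplace (arrivalCdf P τ (m + 1)) s = ∑ a, init a / s * iter M φ (m + 1) a := by
    intro m
    rw [laplace_arrivalCdf h hM hinit hpos hs, Finset.sum_div]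
    exact Finset.sum_congr rfl fun a _ => by ring
  have hsum : Summable fun m => laplace (arrivalCdf P τ (m + 1)) s := by
    simp_rw [hlap]
    exact summable_sum fun a _ => (hren a).mul_left _
  have h2 : HasSum (fun m => laplace (arrivalCdf P τ (m + 1)) s)
      (laplace (fun t => ∑' m, arrivalCdf P τ (m + 1) t) s) :=
    hasSum_laplace (fun m t _ => arrivalCdf_nonneg (P := P) (τ := τ) (m + 1) t)
    (fun m => integrableOn_exp_mul_arrivalCdf hτ hs (m + 1)) hsum
  have h3 : laplace (msd P (position τ ξ)) s =
      v * laplace (fun t => ∑' m, arrivalCdf P τ (m + 1) t) s := by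
    simp only [laplace]
    rw [← integral_const_mul]
    refine setIntegral_congr_fun measurableSet_Ioi fun t ht => ?_
    rw [msd_position h hM hinit hpos (le_of_lt ht)]
    ring
  rw [h3, ← h2.tsum_eq, mul_div_assoc]
  simp_rw [hlap]
  rw [Summable.tsum_finsetSum fun a _ => (hren a).mul_left _, Finset.sum_div]
  congr 1
  refine Finset.sum_congr rfl fun a _ => ?_
  rw [tsum_mul_left, resolventRenewal]
  ring

end Transforms

/-! ### Calculus of asymptotic equivalence. -/

section Equivalents

variable {X : Type*} {l : Filter X}

/-- Nonnegativity excludes cancellation: |v| + |w| = |v + w|, so the two errors remain small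
relative to the sum. -/
lemma isEquivalent_add {u v t w : X → ℝ} (hv : ∀ᶠ x in l, 0 ≤ v x) (hw : ∀ᶠ x in l, 0 ≤ w x)
    (huv : u ~[l] v) (htw : t ~[l] w) : (fun x => u x + t x) ~[l] fun x => v x + w x := by
  refine Asymptotics.isLittleO_iff.2 fun c hc => ?_
  filter_upwards [hv, hw, Asymptotics.isLittleO_iff.1 huv hc,
    Asymptotics.isLittleO_iff.1 htw hc] with x h1 h2 h3 h4
  simp only [Pi.sub_apply, Real.norm_eq_abs] at h3 h4 ⊢
  rw [abs_of_nonneg h1] at h3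
  rw [abs_of_nonneg h2] at h4
  rw [abs_of_nonneg (add_nonneg h1 h2), mul_add, add_sub_add_comm]
  exact (abs_add_le _ _).trans (add_le_add h3 h4)

lemma isEquivalent_sum {ι : Type*} (t : Finset ι) {f g : ι → X → ℝ}
    (hg : ∀ i ∈ t, ∀ᶠ x in l, 0 ≤ g i x) (h : ∀ i ∈ t, f i ~[l] g i) :
    (fun x => ∑ i ∈ t, f i x) ~[l] fun x => ∑ i ∈ t, g i x := by
  classical
  induction t using Finset.induction_on with
  | empty => simpa using Asymptotics.IsEquivalent.refl
  | insert i t hi ih =>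
    simp only [Finset.sum_insert hi]
    refine isEquivalent_add (hg i (Finset.mem_insert_self i t)) ?_
      (h i (Finset.mem_insert_self i t))
      (ih (fun k hk => hg k (Finset.mem_insert_of_mem hk))
        fun k hk => h k (Finset.mem_insert_of_mem hk))
    have : ∀ᶠ x in l, ∀ k ∈ t, 0 ≤ g k x :=
      (Finset.eventually_all t).2 fun k hk => hg k (Finset.mem_insert_of_mem hk)
    filter_upwards [this] with x hx
    exact Finset.sum_nonneg hx

lemma isEquivalent_const_mul (c : ℝ) {u v : X → ℝ} (h : u ~[l] v) :
    (fun x => c * u x) ~[l] fun x => c * v x :=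
  (Asymptotics.IsEquivalent.refl (u := fun _ => c)).mul h

lemma isEquivalent_ofReal {u v : X → ℝ} (h : u ~[l] v) :
    (fun x => (u x : ℂ)) ~[l] fun x => (v x : ℂ) := by
  refine Asymptotics.isLittleO_iff.2 fun c hc => ?_
  filter_upwards [Asymptotics.isLittleO_iff.1 h hc] with x hx
  simp only [Pi.sub_apply] at hx ⊢
  rw [← Complex.ofReal_sub, Complex.norm_real, Complex.norm_real]
  exact hx

lemma isEquivalent_one_sub_exp_neg :
    (fun x : ℝ => 1 - Real.exp (-x)) ~[𝓝 0] fun x => x := by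
  have h1 : HasDerivAt (fun x : ℝ => 1 - Real.exp (-x)) 1 0 := by
    simpa using ((Real.hasDerivAt_exp (-0)).comp (0 : ℝ) (hasDerivAt_neg 0)).const_sub 1
  have h2 := hasDerivAt_iff_isLittleO.1 h1
  simpa [Asymptotics.IsEquivalent, Pi.sub_def] using h2

end Equivalents

/-! ### Asymptotics of the resolvents, block by block. -/

section Block

variable {j : ℕ} {n : Fin j → ℕ} {M : (i : Fin j) → Matrix (Fin (n i)) (Fin (n i)) ℝ}
  {α B eq : State n → ℝ} {wait : State n → Measure ℝ}

lemma tendsto_waitLaplace {μ : Measure ℝ} {a b : ℝ} (ha : 0 < a) (h : IsPowerLawWait μ a b) :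
    Tendsto (fun s => 1 - waitLaplace μ s) (𝓝[>] 0) (𝓝 0) := by
  refine h.laplace_asymp.symm.tendsto_nhds ?_
  have h1 : Tendsto (fun s : ℝ => s ^ a) (𝓝 0) (𝓝 0) := by
    have := (Real.continuousAt_rpow_const 0 a (Or.inr ha.le)).tendsto
    rwa [Real.zero_rpow ha.ne'] at this
  simpa using (h1.mono_left nhdsWithin_le_nhds).const_mul b

lemma psiSum_pos (hB : ∀ a, 0 < B a) {i : Fin j} (hn : 0 < n i) (heq : ∀ r, 0 < eq ⟨i, r⟩)
    {s : ℝ} (hs : 0 < s) : 0 < psiSum α B eq s i :=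
  Finset.sum_pos (fun r _ => mul_pos (mul_pos (hB _) (Real.rpow_pos_of_pos hs _)) (heq r))
    ⟨⟨0, hn⟩, Finset.mem_univ _⟩

lemma resolventRenewal_pos {S : Type*} [Fintype S] [DecidableEq S] {M : Matrix S S ℝ}
    (hM : M ∈ Matrix.rowStochastic ℝ S) {wait : S → Measure ℝ}
    [∀ a, IsProbabilityMeasure (wait a)] (hpos : ∀ a, ∀ᵐ x ∂wait a, 0 < x) {s : ℝ} (hs : 0 < s)
    (a : S) : 0 < resolventRenewal M (fun a => waitLaplace (wait a) s) a := by
  have hφ : ∀ a, 0 ≤ waitLaplace (wait a) s := fun a => waitLaplace_nonneg _ _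
  obtain ⟨ρ, hρ0, hρ1, hρ⟩ := exists_waitLaplace_le hpos hs
  rw [resolventRenewal_eq hM hφ hρ0 hρ1 hρ]
  refine add_pos_of_pos_of_nonneg ?_ (mul_nonneg (hφ a)
    (le_mulVec_apply hM (resolventRenewal_nonneg hM hφ) a))
  exact integral_exp_pos (integrable_exp_neg_mul measurable_id
    ((hpos a).mono fun x hx => le_of_lt hx) hs.le)

lemma isEquivalent_psiSum (hB : ∀ a, 0 < B a) (hwait : ∀ a, IsPowerLawWait (wait a) (α a) (B a))
    {i : Fin j} (heq : ∀ r, 0 < eq ⟨i, r⟩) :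
    (fun s => ∑ r, eq ⟨i, r⟩ * (1 - waitLaplace (wait ⟨i, r⟩) s)) ~[𝓝[>] 0]
      fun s => psiSum α B eq s i := by
  have h1 := isEquivalent_sum (l := 𝓝[>] (0 : ℝ)) Finset.univ
    (f := fun r s => eq ⟨i, r⟩ * (1 - waitLaplace (wait ⟨i, r⟩) s))
    (g := fun r s => eq ⟨i, r⟩ * (B ⟨i, r⟩ * s ^ α ⟨i, r⟩)) (fun r _ => ?_)
    (fun r _ => isEquivalent_const_mul _ (hwait _).laplace_asymp)
  · refine h1.congr_right (Eventually.of_forall fun s => ?_)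
    exact Finset.sum_congr rfl fun r _ => mul_comm _ _
  · filter_upwards [self_mem_nhdsWithin] with s hs
    have hs' : (0 : ℝ) < s := hs
    have := heq r
    have := hB ⟨i, r⟩
    positivity

/-- The defective Poisson equation with f = 1 - φ and E = 1 - qφ; the limit is the same for every
starting state `r` of the block. -/
lemma isEquivalent_survival (hn : ∀ i, 0 < n i)
    (hM : ∀ i, M i ∈ Matrix.rowStochastic ℝ (Fin (n i)))
    (hirr : ∀ i, (M i).IsIrreducible) (hα : ∀ a, 0 < α a) (hB : ∀ a, 0 < B a)
    (hwait : ∀ a, IsPowerLawWait (wait a) (α a) (B a)) (σ : ℝ)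
    (heqM : IsEquilibrium (Matrix.blockDiagonal' M) eq) {i : Fin j} (heq : ∀ r, 0 < eq ⟨i, r⟩)
    (r : Fin (n i)) :
    (fun p : ℝ × ℝ => resolventSurvival (Matrix.blockDiagonal' M)
        (fun a => waitLaplace (wait a) p.2) (Real.exp (-(σ ^ 2 * p.1 ^ 2))) ⟨i, r⟩)
      ~[𝓝 (0 : ℝ) ×ˢ 𝓝[>] (0 : ℝ)]
    fun p => psiSum α B eq p.2 i / (psiSum α B eq p.2 i + σ ^ 2 * p.1 ^ 2 * blockSum eq i) := by
  have hwait1 := fun a => (hwait a).isProbabilityMeasure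
  have hpos := fun a => (hwait a).pos
  have hMb := blockDiagonal'_mem_rowStochastic hM
  set l : Filter (ℝ × ℝ) := 𝓝 (0 : ℝ) ×ˢ 𝓝[>] (0 : ℝ) with hl
  set φ : ℝ → State n → ℝ := fun s a => waitLaplace (wait a) s with hφdef
  set q : ℝ → ℝ := fun k => Real.exp (-(σ ^ 2 * k ^ 2)) with hqdef
  have hspos : ∀ᶠ p : ℝ × ℝ in l, 0 < p.2 := tendsto_snd.eventually self_mem_nhdsWithin
  have hq0 : ∀ k, 0 ≤ q k := fun k => (Real.exp_pos _).le
  have hq1 : ∀ k, q k ≤ 1 := fun k => Real.exp_le_one_iff.2 (by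
    have : 0 ≤ σ ^ 2 * k ^ 2 := by positivity
    linarith)
  have hφ0 : ∀ s a, 0 ≤ φ s a := fun s a => waitLaplace_nonneg _ _
  have hφ1 : ∀ s, 0 < s → ∀ a, φ s a < 1 := fun s hs a => waitLaplace_lt_one (hpos a) hs
  have hsq : Tendsto (fun p : ℝ × ℝ => σ ^ 2 * p.1 ^ 2) l (𝓝 0) := by
    have : Tendsto (fun k : ℝ => σ ^ 2 * k ^ 2) (𝓝 0) (𝓝 0) := by
      have h : Continuous fun k : ℝ => σ ^ 2 * k ^ 2 := by fun_prop
      simpa using h.tendsto 0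
    exact this.comp tendsto_fst
  have hqlim : Tendsto (fun p : ℝ × ℝ => q p.1) l (𝓝 1) := by
    simpa [hqdef, Function.comp_def] using (Real.continuous_exp.tendsto _).comp hsq.neg
  have h1φ : ∀ a, Tendsto (fun p : ℝ × ℝ => 1 - φ p.2 a) l (𝓝 0) := fun a =>
    (tendsto_waitLaplace (hα a) (hwait a)).comp tendsto_snd
  have hE0 : ∀ a, Tendsto (fun p : ℝ × ℝ => 1 - q p.1 * φ p.2 a) l (𝓝 0) := by
    intro a
    have h1 : Tendsto (fun p : ℝ × ℝ => 1 - q p.1 * (1 - (1 - φ p.2 a))) l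
        (𝓝 (1 - 1 * (1 - 0))) := ((hqlim.mul ((h1φ a).const_sub 1)).const_sub 1)
    simpa using h1
  have hE : ∀ s, 0 < s → ∀ k a, 0 < 1 - q k * φ s a := fun s hs k a => by
    have := mul_le_of_le_one_left (hφ0 s a) (hq1 k)
    linarith [hφ1 s hs a]
  have key := isEquivalent_poisson (hM i) (hirr i) heq (equilibrium_block heqM i) (l := l)
    (u := fun p r => resolventSurvival (Matrix.blockDiagonal' M) (φ p.2) (q p.1) ⟨i, r⟩)
    (f := fun p r => 1 - φ p.2 ⟨i, r⟩) (E := fun p r => 1 - q p.1 * φ p.2 ⟨i, r⟩)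
    (by
      filter_upwards [hspos] with p hp r
      exact resolventSurvival_nonneg hMb (hφ0 _) (fun a => (hφ1 _ hp a).le) (hq0 _) _)
    (by
      filter_upwards [hspos] with p hp r
      exact sub_nonneg.2 (hφ1 _ hp _).le)
    (by
      filter_upwards [hspos] with p hp r
      exact (hE _ hp _ _).le)
    (fun r => hE0 _)
    (by
      filter_upwards [hspos] with p hp r
      obtain ⟨ρ, hρ0, hρ1, hρ⟩ := exists_waitLaplace_le hpos hp
      rw [resolventSurvival_eq hMb (hφ0 _) hρ0 hρ1 hρ (hq0 _) (hq1 _), sub_sub_cancel,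
        blockDiagonal'_mulVec_apply]) r
  have hnum : (fun p : ℝ × ℝ => ∑ r, eq ⟨i, r⟩ * (1 - φ p.2 ⟨i, r⟩)) ~[l]
      fun p => psiSum α B eq p.2 i :=
    (isEquivalent_psiSum hB hwait heq).comp_tendsto tendsto_snd
  have hψ : ∀ᶠ p : ℝ × ℝ in l, 0 ≤ psiSum α B eq p.2 i :=
    hspos.mono fun p hp => (psiSum_pos hB (hn i) heq hp).le
  have hbs : 0 < blockSum eq i :=
    Finset.sum_pos (fun r _ => heq r) ⟨r, Finset.mem_univ r⟩
  have hden : (fun p : ℝ × ℝ => ∑ r, eq ⟨i, r⟩ * (1 - q p.1 * φ p.2 ⟨i, r⟩)) ~[l]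
      fun p => psiSum α B eq p.2 i + σ ^ 2 * p.1 ^ 2 * blockSum eq i := by
    -- Decompose 1 - qφ = q(1 - φ) + (1 - q); both parts are nonnegative, so their equivalents may
    -- be added whatever the relative size of `k` and `s`.
    have h1 : (fun p : ℝ × ℝ => q p.1 * ∑ r, eq ⟨i, r⟩ * (1 - φ p.2 ⟨i, r⟩)) ~[l]
        fun p => psiSum α B eq p.2 i := by
      have := ((Asymptotics.isEquivalent_const_iff_tendsto one_ne_zero).2 hqlim).mul hnum
      refine this.congr_right (Eventually.of_forall fun p => ?_)
      simp
    have h2 : (fun p : ℝ × ℝ => blockSum eq i * (1 - q p.1)) ~[l]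
        fun p => blockSum eq i * (σ ^ 2 * p.1 ^ 2) :=
      isEquivalent_const_mul _ (isEquivalent_one_sub_exp_neg.comp_tendsto hsq)
    have h3 := isEquivalent_add hψ (Eventually.of_forall fun p => by positivity) h1 h2
    refine (h3.congr_left (Eventually.of_forall fun p => ?_)).congr_right
      (Eventually.of_forall fun p => ?_)
    · simp only [blockSum]
      rw [Finset.mul_sum, Finset.sum_mul, ← Finset.sum_add_distrib]
      exact Finset.sum_congr rfl fun r _ => by ring
    · simp only
      ring
  refine ((key.trans hnum).div hden).congr_left ?_
  filter_upwards [hspos] with p hp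
  have hA : 0 < ∑ r, eq ⟨i, r⟩ * (1 - q p.1 * φ p.2 ⟨i, r⟩) :=
    Finset.sum_pos (fun r _ => mul_pos (heq r) (hE _ hp _ _)) ⟨r, Finset.mem_univ r⟩
  exact mul_div_cancel_right₀ _ hA.ne'

/-- Here f = φ tends to 1, so ⟨e, f⟩ tends to the mass of the block, while E = 1 - φ produces
`psiSum`. -/
lemma isEquivalent_renewal
    (hM : ∀ i, M i ∈ Matrix.rowStochastic ℝ (Fin (n i)))
    (hirr : ∀ i, (M i).IsIrreducible) (hα : ∀ a, 0 < α a) (hB : ∀ a, 0 < B a)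
    (hwait : ∀ a, IsPowerLawWait (wait a) (α a) (B a))
    (heqM : IsEquilibrium (Matrix.blockDiagonal' M) eq) {i : Fin j} (heq : ∀ r, 0 < eq ⟨i, r⟩)
    (r : Fin (n i)) :
    (fun s => resolventRenewal (Matrix.blockDiagonal' M) (fun a => waitLaplace (wait a) s) ⟨i, r⟩)
      ~[𝓝[>] (0 : ℝ)] fun s => blockSum eq i / psiSum α B eq s i := by
  have hwait1 := fun a => (hwait a).isProbabilityMeasure
  have hpos := fun a => (hwait a).pos
  have hMb := blockDiagonal'_mem_rowStochastic hM
  set φ : ℝ → State n → ℝ := fun s a => waitLaplace (wait a) s with hφdef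
  have hφ0 : ∀ s a, 0 ≤ φ s a := fun s a => waitLaplace_nonneg _ _
  have hφ1 : ∀ s, 0 < s → ∀ a, φ s a < 1 := fun s hs a => waitLaplace_lt_one (hpos a) hs
  have hspos : ∀ᶠ s : ℝ in 𝓝[>] 0, 0 < s := self_mem_nhdsWithin
  have key := isEquivalent_poisson (hM i) (hirr i) heq (equilibrium_block heqM i)
    (l := 𝓝[>] (0 : ℝ))
    (u := fun s r => resolventRenewal (Matrix.blockDiagonal' M) (φ s) ⟨i, r⟩)
    (f := fun s r => φ s ⟨i, r⟩) (E := fun s r => 1 - φ s ⟨i, r⟩)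
    (Eventually.of_forall fun s r => resolventRenewal_nonneg hMb (hφ0 _) _)
    (Eventually.of_forall fun s r => hφ0 _ _)
    (by
      filter_upwards [hspos] with p hp r
      exact sub_nonneg.2 (hφ1 _ hp _).le)
    (fun r => tendsto_waitLaplace (hα _) (hwait _))
    (by
      filter_upwards [hspos] with s hs r
      obtain ⟨ρ, hρ0, hρ1, hρ⟩ := exists_waitLaplace_le hpos hs
      rw [resolventRenewal_eq hMb (hφ0 _) hρ0 hρ1 hρ, sub_sub_cancel,
        blockDiagonal'_mulVec_apply]) r
  have hbs : 0 < blockSum eq i :=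
    Finset.sum_pos (fun r _ => heq r) ⟨r, Finset.mem_univ r⟩
  have hnum : (fun s => ∑ r, eq ⟨i, r⟩ * φ s ⟨i, r⟩) ~[𝓝[>] (0 : ℝ)] fun _ => blockSum eq i := by
    refine (Asymptotics.isEquivalent_const_iff_tendsto hbs.ne').2 ?_
    refine tendsto_finsetSum _ fun r _ => ?_
    have h1 := ((tendsto_waitLaplace (hα ⟨i, r⟩) (hwait _)).const_sub 1).const_mul (eq ⟨i, r⟩)
    simpa using h1
  refine ((key.trans hnum).div (isEquivalent_psiSum hB hwait heq)).congr_left ?_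
  filter_upwards [hspos] with s hs
  have hA : 0 < ∑ r, eq ⟨i, r⟩ * (1 - φ s ⟨i, r⟩) :=
    Finset.sum_pos (fun r _ => mul_pos (heq r) (sub_pos.2 (hφ1 _ hs _))) ⟨r, Finset.mem_univ r⟩
  exact mul_div_cancel_right₀ _ hA.ne'

lemma sum_state_eq_sum_charged {init : State n → ℝ} (F : State n → ℝ) :
    ∑ a, init a * F a = ∑ i ∈ charged init, ∑ r, init ⟨i, r⟩ * F ⟨i, r⟩ := by
  rw [Fintype.sum_sigma, charged, Finset.sum_filter]
  refine Finset.sum_congr rfl fun i _ => ?_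
  split_ifs with h
  · rfl
  · push Not at h
    exact Finset.sum_eq_zero fun r _ => by rw [h r, zero_mul]

lemma blockSum_pos_of_mem_charged {init : State n → ℝ} (hinit : IsDistribution init) {i : Fin j}
    (hi : i ∈ charged init) : 0 < blockSum init i := by
  obtain ⟨r, hr⟩ := (Finset.mem_filter.1 hi).2
  exact Finset.sum_pos' (fun r _ => hinit.1 _)
    ⟨r, Finset.mem_univ r, lt_of_le_of_ne (hinit.1 _) (Ne.symm hr)⟩

lemma charged_nonempty {init : State n → ℝ} (hinit : IsDistribution init) :
    (charged init).Nonempty := by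
  obtain ⟨⟨i, r⟩, -, h⟩ := Finset.exists_ne_zero_of_sum_ne_zero
    (show ∑ a, init a ≠ 0 by rw [hinit.2]; exact one_ne_zero)
  exact ⟨i, Finset.mem_filter.2 ⟨Finset.mem_univ i, r, h⟩⟩

lemma isEquivalent_survival_total (hn : ∀ i, 0 < n i)
    (hM : ∀ i, M i ∈ Matrix.rowStochastic ℝ (Fin (n i)))
    (hirr : ∀ i, (M i).IsIrreducible) (hα : ∀ a, 0 < α a) (hB : ∀ a, 0 < B a)
    (hwait : ∀ a, IsPowerLawWait (wait a) (α a) (B a)) (σ : ℝ)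
    (heqM : IsEquilibrium (Matrix.blockDiagonal' M) eq) {init : State n → ℝ}
    (hinit : IsDistribution init) (heq : ∀ i ∈ charged init, ∀ r, 0 < eq ⟨i, r⟩) :
    (fun p : ℝ × ℝ => (∑ a, init a * resolventSurvival (Matrix.blockDiagonal' M)
        (fun a => waitLaplace (wait a) p.2) (Real.exp (-(σ ^ 2 * p.1 ^ 2))) a) / p.2)
      ~[𝓝 (0 : ℝ) ×ˢ 𝓝[>] (0 : ℝ)]
    fun p => ∑ i ∈ charged init, 1 / p.2 * (psiSum α B eq p.2 i * blockSum init i /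
      (psiSum α B eq p.2 i + σ ^ 2 * p.1 ^ 2 * blockSum eq i)) := by
  have hspos : ∀ᶠ p : ℝ × ℝ in 𝓝 (0 : ℝ) ×ˢ 𝓝[>] (0 : ℝ), 0 < p.2 :=
    tendsto_snd.eventually self_mem_nhdsWithin
  have hnn : ∀ i ∈ charged init, ∀ᶠ p : ℝ × ℝ in 𝓝 (0 : ℝ) ×ˢ 𝓝[>] (0 : ℝ),
      0 ≤ psiSum α B eq p.2 i / (psiSum α B eq p.2 i + σ ^ 2 * p.1 ^ 2 * blockSum eq i) := by
    intro i hi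
    filter_upwards [hspos] with p hp
    have h1 := psiSum_pos (α := α) hB (hn i) (heq i hi) hp
    have h2 : 0 ≤ blockSum eq i := Finset.sum_nonneg fun r _ => (heq i hi r).le
    positivity
  have h1 := isEquivalent_sum (l := 𝓝 (0 : ℝ) ×ˢ 𝓝[>] (0 : ℝ)) (charged init)
    (fun i hi => by
      filter_upwards [hnn i hi] with p hp
      exact Finset.sum_nonneg fun r (_ : r ∈ Finset.univ) =>
        mul_nonneg (hinit.1 ⟨i, r⟩) hp)
    fun i hi => isEquivalent_sum Finset.univ
      (fun r _ => (hnn i hi).mono fun p hp => mul_nonneg (hinit.1 ⟨i, r⟩) hp)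
      fun r _ => isEquivalent_const_mul (init ⟨i, r⟩)
        (isEquivalent_survival hn hM hirr hα hB hwait σ heqM (heq i hi) r)
  refine ((h1.div (Asymptotics.IsEquivalent.refl (u := fun p : ℝ × ℝ => p.2))).congr_left
    (Eventually.of_forall fun p => ?_)).congr_right (Eventually.of_forall fun p => ?_)
  · rw [sum_state_eq_sum_charged]
    rfl
  · simp only [Pi.div_apply]
    rw [Finset.sum_div]
    refine Finset.sum_congr rfl fun i _ => ?_
    rw [← Finset.sum_mul, show ∑ r, init ⟨i, r⟩ = blockSum init i from rfl]
    ring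

lemma isEquivalent_renewal_total (hn : ∀ i, 0 < n i)
    (hM : ∀ i, M i ∈ Matrix.rowStochastic ℝ (Fin (n i)))
    (hirr : ∀ i, (M i).IsIrreducible) (hα : ∀ a, 0 < α a) (hB : ∀ a, 0 < B a)
    (hwait : ∀ a, IsPowerLawWait (wait a) (α a) (B a)) (σ : ℝ)
    (heqM : IsEquilibrium (Matrix.blockDiagonal' M) eq) {init : State n → ℝ}
    (hinit : IsDistribution init) (heq : ∀ i ∈ charged init, ∀ r, 0 < eq ⟨i, r⟩) :
    (fun s => 2 * σ ^ 2 * (∑ a, init a * resolventRenewal (Matrix.blockDiagonal' M)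
        (fun a => waitLaplace (wait a) s) a) / s)
      ~[𝓝[>] (0 : ℝ)]
    fun s => ∑ i ∈ charged init, 2 * σ ^ 2 * blockSum init i * blockSum eq i /
            (s * psiSum α B eq s i) := by
  have hnn : ∀ i ∈ charged init, ∀ᶠ s : ℝ in 𝓝[>] (0 : ℝ),
      0 ≤ blockSum eq i / psiSum α B eq s i := by
    intro i hi
    filter_upwards [self_mem_nhdsWithin] with s hs
    have h1 := psiSum_pos (α := α) hB (hn i) (heq i hi) hs
    have h2 : 0 ≤ blockSum eq i := Finset.sum_nonneg fun r _ => (heq i hi r).le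
    positivity
  have h1 := isEquivalent_sum (l := 𝓝[>] (0 : ℝ)) (charged init)
    (fun i hi => by
      filter_upwards [hnn i hi] with p hp
      exact Finset.sum_nonneg fun r (_ : r ∈ Finset.univ) =>
        mul_nonneg (hinit.1 ⟨i, r⟩) hp)
    fun i hi => isEquivalent_sum Finset.univ
      (fun r _ => (hnn i hi).mono fun p hp => mul_nonneg (hinit.1 ⟨i, r⟩) hp)
      fun r _ => isEquivalent_const_mul (init ⟨i, r⟩)
        (isEquivalent_renewal hM hirr hα hB hwait heqM (heq i hi) r)
  refine (((isEquivalent_const_mul (2 * σ ^ 2) h1).div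
    (Asymptotics.IsEquivalent.refl (u := fun s : ℝ => s))).congr_left
    (Eventually.of_forall fun s => ?_)).congr_right (Eventually.of_forall fun s => ?_)
  · rw [sum_state_eq_sum_charged]
    rfl
  · simp only [Pi.div_apply]
    rw [Finset.mul_sum, Finset.sum_div]
    refine Finset.sum_congr rfl fun i _ => ?_
    rw [← Finset.sum_mul, show ∑ r, init ⟨i, r⟩ = blockSum init i from rfl]
    rw [mul_comm s]
    simp only [div_eq_mul_inv, mul_inv]
    ring

end Block

/-! ### Selection of the dominant exponents. -/

section Exponents

variable {j : ℕ} {n : Fin j → ℕ} {α B eq init : State n → ℝ}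

lemma minExponent_le (i : Fin j) (r : Fin (n i)) : minExponent α i ≤ α ⟨i, r⟩ :=
  ciInf_le (Finite.bddBelow_range _) r

lemma exists_eq_minExponent {i : Fin j} (hn : 0 < n i) :
    ∃ r : Fin (n i), α ⟨i, r⟩ = minExponent α i :=
  have : Nonempty (Fin (n i)) := ⟨⟨0, hn⟩⟩
  exists_eq_ciInf_of_finite

lemma minExponent_le_alphaStar {i : Fin j} (hi : i ∈ charged init) :
    minExponent α i ≤ alphaStar α init :=
  le_ciSup (f := fun i : {i : Fin j // i ∈ charged init} => minExponent α i)
    (Finite.bddAbove_range _) ⟨i, hi⟩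

lemma exists_eq_alphaStar (hinit : IsDistribution init) :
    ∃ i ∈ charged init, minExponent α i = alphaStar α init := by
  have : Nonempty {i : Fin j // i ∈ charged init} := (charged_nonempty hinit).to_subtype
  obtain ⟨i, hi⟩ := exists_eq_ciSup_of_finite
    (f := fun i : {i : Fin j // i ∈ charged init} => minExponent α i)
  exact ⟨i, i.2, hi⟩

/-- Leading coefficient of `psiSum`. -/
noncomputable def leadingCoeff (α B eq : State n → ℝ) (i : Fin j) (a : ℝ) : ℝ :=
  ∑ r ∈ Finset.univ.filter fun r : Fin (n i) => α ⟨i, r⟩ = a, B ⟨i, r⟩ * eq ⟨i, r⟩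

lemma leadingCoeff_pos (hB : ∀ a, 0 < B a) {i : Fin j} (hn : 0 < n i)
    (heq : ∀ r, 0 < eq ⟨i, r⟩) : 0 < leadingCoeff α B eq i (minExponent α i) := by
  obtain ⟨r, hr⟩ := exists_eq_minExponent (α := α) hn
  exact Finset.sum_pos (fun r _ => mul_pos (hB _) (heq r))
    ⟨r, Finset.mem_filter.2 ⟨Finset.mem_univ r, hr⟩⟩

lemma tendsto_rpow_nhdsGT_zero {a : ℝ} (ha : 0 < a) :
    Tendsto (fun s : ℝ => s ^ a) (𝓝[>] 0) (𝓝 0) := by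
  have := (Real.continuousAt_rpow_const 0 a (Or.inr ha.le)).tendsto
  rw [Real.zero_rpow ha.ne'] at this
  exact this.mono_left nhdsWithin_le_nhds

/-- After division every state keeps a nonnegative power of s; only those with the minimal exponent
keep the power zero. -/
lemma tendsto_psiSum_div (i : Fin j) :
    Tendsto (fun s => psiSum α B eq s i / s ^ minExponent α i) (𝓝[>] 0)
      (𝓝 (leadingCoeff α B eq i (minExponent α i))) := by
  rw [leadingCoeff, Finset.sum_filter]
  simp only [psiSum, blockSum, Finset.sum_div]
  refine tendsto_finsetSum _ fun r _ => ?_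
  have hdiv : ∀ᶠ s : ℝ in 𝓝[>] 0, B ⟨i, r⟩ * eq ⟨i, r⟩ * s ^ (α ⟨i, r⟩ - minExponent α i) =
      B ⟨i, r⟩ * s ^ α ⟨i, r⟩ * eq ⟨i, r⟩ / s ^ minExponent α i := by
    filter_upwards [self_mem_nhdsWithin] with s hs
    rw [Real.rpow_sub hs]
    ring
  refine Tendsto.congr' hdiv ?_
  split_ifs with h
  · simp [h]
  · have h1 := tendsto_rpow_nhdsGT_zero (sub_pos.2 (lt_of_le_of_ne
      (minExponent_le (α := α) i r) (Ne.symm h)))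
    simpa using h1.const_mul (B ⟨i, r⟩ * eq ⟨i, r⟩)

/-- The quotient behaves like s^(a - min), so blocks whose minimal exponent is below `a` drop out.
Applied with `a` equal to `alphaStar`. -/
lemma tendsto_rpow_div_psiSum (hB : ∀ a, 0 < B a) {i : Fin j} (hn : 0 < n i)
    (heq : ∀ r, 0 < eq ⟨i, r⟩) {a : ℝ} (ha : minExponent α i ≤ a) :
    Tendsto (fun s => s ^ a / psiSum α B eq s i) (𝓝[>] 0)
      (𝓝 (if minExponent α i = a then (leadingCoeff α B eq i a)⁻¹ else 0)) := by
  have h1 := (tendsto_psiSum_div (α := α) (B := B) (eq := eq) i).inv₀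
    (leadingCoeff_pos hB hn heq).ne'
  have hdiv : ∀ᶠ s : ℝ in 𝓝[>] 0,
      s ^ (a - minExponent α i) * (psiSum α B eq s i / s ^ minExponent α i)⁻¹ =
      s ^ a / psiSum α B eq s i := by
    filter_upwards [self_mem_nhdsWithin] with s hs
    have h2 := Real.rpow_pos_of_pos hs (minExponent α i)
    rw [Real.rpow_sub hs, inv_div]
    field_simp
  refine Tendsto.congr' hdiv ?_
  split_ifs with h
  · rw [← h]
    simpa using h1
  · simpa using (tendsto_rpow_nhdsGT_zero (sub_pos.2 (lt_of_le_of_ne ha h))).mul h1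

lemma msdCoeff_mul_Gamma (σ : ℝ) (hpos : 0 < Real.Gamma (1 + alphaStar α init)) :
    msdCoeff α B eq init σ * Real.Gamma (1 + alphaStar α init) =
      ∑ i ∈ charged init, 2 * σ ^ 2 * blockSum init i * blockSum eq i *
        (if minExponent α i = alphaStar α init then
          (leadingCoeff α B eq i (alphaStar α init))⁻¹ else 0) := by
  rw [msdCoeff, div_mul_cancel₀ _ hpos.ne', Finset.sum_filter]
  refine Finset.sum_congr rfl fun i _ => ?_
  split_ifs with h
  · rfl
  · rw [mul_zero]

lemma alphaStar_pos (hn : ∀ i, 0 < n i) (hα : ∀ a, 0 < α a) (hinit : IsDistribution init) :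
    0 < alphaStar α init := by
  obtain ⟨i, -, hi⟩ := exists_eq_alphaStar (α := α) hinit
  obtain ⟨r, hr⟩ := exists_eq_minExponent (α := α) (hn i)
  rw [← hi, ← hr]
  exact hα _

lemma msdCoeff_pos (hn : ∀ i, 0 < n i) (hα : ∀ a, 0 < α a) (hB : ∀ a, 0 < B a)
    (hinit : IsDistribution init) (heq : ∀ i ∈ charged init, ∀ r, 0 < eq ⟨i, r⟩) {σ : ℝ}
    (hσ : 0 < σ) : 0 < msdCoeff α B eq init σ := by
  have hΓ : 0 < Real.Gamma (1 + alphaStar α init) :=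
    Real.Gamma_pos_of_pos (by linarith [alphaStar_pos hn hα hinit])
  refine div_pos (Finset.sum_pos (fun i hi => ?_) ?_) hΓ
  · obtain ⟨hi, hmin⟩ := Finset.mem_filter.1 hi
    have h1 := leadingCoeff_pos (α := α) hB (hn i) (heq i hi)
    rw [hmin] at h1
    have h2 := blockSum_pos_of_mem_charged hinit hi
    have h3 : 0 < blockSum eq i :=
      Finset.sum_pos (fun r _ => heq i hi r) ⟨⟨0, hn i⟩, Finset.mem_univ _⟩
    exact div_pos (by positivity) h1
  · obtain ⟨i, hi, h⟩ := exists_eq_alphaStar (α := α) hinit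
    exact ⟨i, Finset.mem_filter.2 ⟨hi, h⟩⟩

lemma tendsto_rpow_mul_laplace (hn : ∀ i, 0 < n i) (hα : ∀ a, 0 < α a) (hB : ∀ a, 0 < B a)
    (hinit : IsDistribution init) (heq : ∀ i ∈ charged init, ∀ r, 0 < eq ⟨i, r⟩) (σ : ℝ) :
    Tendsto (fun s => s ^ (1 + alphaStar α init) *
      ∑ i ∈ charged init, 2 * σ ^ 2 * blockSum init i * blockSum eq i /
        (s * psiSum α B eq s i)) (𝓝[>] 0)
      (𝓝 (msdCoeff α B eq init σ * Real.Gamma (1 + alphaStar α init))) := by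
  rw [msdCoeff_mul_Gamma σ (Real.Gamma_pos_of_pos (by linarith [alphaStar_pos hn hα hinit]))]
  simp_rw [Finset.mul_sum]
  refine tendsto_finsetSum _ fun i hi => ?_
  have h1 := (tendsto_rpow_div_psiSum hB (hn i) (heq i hi)
    (minExponent_le_alphaStar (α := α) hi)).const_mul
    (2 * σ ^ 2 * blockSum init i * blockSum eq i)
  refine h1.congr' ?_
  filter_upwards [self_mem_nhdsWithin] with s hs
  have hs' : (0 : ℝ) < s := hs
  have h2 := psiSum_pos (α := α) hB (hn i) (heq i hi) hs
  rw [Real.rpow_add hs', Real.rpow_one]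
  field_simp

end Exponents

end FCP

/-! ### The main theorem. -/

theorem mainTheorem3
    {j : ℕ} (n : Fin j → ℕ) (hn : ∀ i, 0 < n i)
    (M : (i : Fin j) → Matrix (Fin (n i)) (Fin (n i)) ℝ)
    (hM : ∀ i, M i ∈ Matrix.rowStochastic ℝ (Fin (n i)))
    (hirr : ∀ i, (M i).IsIrreducible)
    (init : FCP.State n → ℝ) (hinit : FCP.IsDistribution init)
    (α B : FCP.State n → ℝ) (hα : ∀ a, 0 < α a ∧ α a < 1) (hB : ∀ a, 0 < B a)
    (σ : ℝ) (hσ : 0 < σ)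
    (wait : FCP.State n → Measure ℝ) (hwait : ∀ a, FCP.IsPowerLawWait (wait a) (α a) (B a))
    {Ω : Type*} [MeasurableSpace Ω] (P : Measure Ω) [IsProbabilityMeasure P]
    (Z : ℕ → Ω → FCP.State n) (τ ξ : ℕ → Ω → ℝ)
    (hwalk : FCP.IsInternalStateWalk P init (Matrix.blockDiagonal' M) wait
      (fun _ => gaussianReal 0 (Real.toNNReal (2 * σ ^ 2))) Z τ ξ) :
    (∃ eq : FCP.State n → ℝ,
      FCP.IsEquilibrium (Matrix.blockDiagonal' M) eq ∧ ∀ i, FCP.blockSum eq i ≠ 0) ∧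
    ∀ eq : FCP.State n → ℝ, FCP.IsEquilibrium (Matrix.blockDiagonal' M) eq →
      (∀ i ∈ FCP.charged init, FCP.blockSum eq i ≠ 0) →
      ((fun p : ℝ × ℝ => FCP.fourierLaplace P (FCP.position τ ξ) p.1 p.2)
        ~[𝓝 (0 : ℝ) ×ˢ 𝓝[>] (0 : ℝ)]
        fun p : ℝ × ℝ => ((∑ i ∈ FCP.charged init,
          1 / p.2 * (FCP.psiSum α B eq p.2 i * FCP.blockSum init i /
            (FCP.psiSum α B eq p.2 i + σ ^ 2 * p.1 ^ 2 * FCP.blockSum eq i)) : ℝ) : ℂ)) ∧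
      (FCP.laplace (FCP.msd P (FCP.position τ ξ)) ~[𝓝[>] (0 : ℝ)]
        fun s : ℝ => ∑ i ∈ FCP.charged init,
          2 * σ ^ 2 * FCP.blockSum init i * FCP.blockSum eq i /
            (s * FCP.psiSum α B eq s i)) ∧
      0 < FCP.msdCoeff α B eq init σ ∧
      (FCP.msd P (FCP.position τ ξ) ~[atTop]
        fun t : ℝ => FCP.msdCoeff α B eq init σ * t ^ FCP.alphaStar α init) := by
  have hj : 0 < j := by
    obtain ⟨i, -⟩ := FCP.charged_nonempty hinit
    exact i.pos
  refine ⟨FCP.exists_equilibrium hj hn hM, fun eq heqM heq0 => ?_⟩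
  have hα0 : ∀ a, 0 < α a := fun a => (hα a).1
  have hwait1 := fun a => (hwait a).isProbabilityMeasure
  have hpos := fun a => (hwait a).pos
  have hMb := FCP.blockDiagonal'_mem_rowStochastic hM
  -- Only the restriction to a charged block is used; it is stationary for that block and nonzero,
  -- hence strictly positive.
  have heq : ∀ i ∈ FCP.charged init, ∀ r, 0 < eq ⟨i, r⟩ := fun i hi =>
    FCP.stationary_pos (hirr i) (fun r => heqM.1.1 ⟨i, r⟩) (heq0 i hi)
      (FCP.equilibrium_block heqM i)
  have hv : ((Real.toNNReal (2 * σ ^ 2) : NNReal) : ℝ) = 2 * σ ^ 2 :=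
    Real.coe_toNNReal _ (by positivity)
  have hlap : ∀ s, 0 < s → FCP.laplace (FCP.msd P (FCP.position τ ξ)) s =
      2 * σ ^ 2 * (∑ a, init a * FCP.resolventRenewal (Matrix.blockDiagonal' M)
        (fun a => FCP.waitLaplace (wait a) s) a) / s := fun s hs => by
    rw [FCP.laplace_msd_position hwalk hMb hinit hpos hs, hv]
  have hmsd : FCP.laplace (FCP.msd P (FCP.position τ ξ)) ~[𝓝[>] (0 : ℝ)]
      fun s : ℝ => ∑ i ∈ FCP.charged init, 2 * σ ^ 2 * FCP.blockSum init i * FCP.blockSum eq i /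
        (s * FCP.psiSum α B eq s i) := by
    refine (FCP.isEquivalent_renewal_total hn hM hirr hα0 hB hwait σ heqM hinit heq).congr_left ?_
    filter_upwards [self_mem_nhdsWithin] with s hs
    exact (hlap s hs).symm
  have hc := FCP.msdCoeff_pos hn hα0 hB hinit heq hσ
  refine ⟨?_, hmsd, hc, ?_⟩
  · refine (FCP.isEquivalent_ofReal (FCP.isEquivalent_survival_total hn hM hirr hα0 hB hwait σ heqM
      hinit heq)).congr_left ?_
    have hspos : ∀ᶠ p : ℝ × ℝ in 𝓝 (0 : ℝ) ×ˢ 𝓝[>] (0 : ℝ), 0 < p.2 :=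
      tendsto_snd.eventually self_mem_nhdsWithin
    filter_upwards [hspos] with p hp
    rw [FCP.fourierLaplace_position hwalk hMb hinit hpos hp, hv,
      show 2 * σ ^ 2 * p.1 ^ 2 / 2 = σ ^ 2 * p.1 ^ 2 by ring]
  · have hint : ∀ s, 0 < s → IntegrableOn
        (fun t => Real.exp (-(s * t)) * FCP.msd P (FCP.position τ ξ) t) (Set.Ioi 0) := by
      intro s hs
      -- A nonintegrable integrand would have integral 0 by convention, yet the closed form of the
      -- transform is strictly positive.
      by_contra hni
      have h0 : FCP.laplace (FCP.msd P (FCP.position τ ξ)) s = 0 := integral_undef hni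
      obtain ⟨a, -, ha⟩ := Finset.exists_ne_zero_of_sum_ne_zero
        (show ∑ a, init a ≠ 0 by rw [hinit.2]; exact one_ne_zero)
      have hren : ∀ a, 0 < FCP.resolventRenewal (Matrix.blockDiagonal' M)
          (fun a => FCP.waitLaplace (wait a) s) a :=
        fun a => FCP.resolventRenewal_pos hMb hpos hs a
      have h1 : 0 < ∑ a, init a * FCP.resolventRenewal (Matrix.blockDiagonal' M)
          (fun a => FCP.waitLaplace (wait a) s) a :=
        Finset.sum_pos' (fun a _ => mul_nonneg (hinit.1 a) (hren a).le) ⟨a, Finset.mem_univ a,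
          mul_pos (lt_of_le_of_ne (hinit.1 a) (Ne.symm ha)) (hren a)⟩
      rw [hlap s hs] at h0
      exact absurd h0 (by positivity)
    have hlim : Tendsto (fun s => s ^ (1 + FCP.alphaStar α init) *
        FCP.laplace (FCP.msd P (FCP.position τ ξ)) s) (𝓝[>] 0)
        (𝓝 (FCP.msdCoeff α B eq init σ * Real.Gamma (1 + FCP.alphaStar α init))) :=
      ((Asymptotics.IsEquivalent.refl (u := fun s : ℝ => s ^ (1 + FCP.alphaStar α init))).mul
        hmsd).symm.tendsto_nhds (FCP.tendsto_rpow_mul_laplace hn hα0 hB hinit heq σ)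
    have htaub := FCP.tendsto_div_rpow_of_laplace
      (fun t _ => integral_nonneg fun ω => sq_nonneg (FCP.position τ ξ t ω))
      (FCP.msd_monotoneOn hwalk hMb hinit hpos) hint hc.le (FCP.alphaStar_pos hn hα0 hinit) hlim
    refine (((Asymptotics.isEquivalent_const_iff_tendsto hc.ne').2 htaub).mul
      (Asymptotics.IsEquivalent.refl
        (u := fun t : ℝ => t ^ FCP.alphaStar α init))).congr_left ?_
    filter_upwards [eventually_gt_atTop 0] with t ht
    exact div_mul_cancel₀ _ (Real.rpow_pos_of_pos ht _).ne'
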